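/- Let $U$ be an open set in the space of coordinates $(\tau,\rho,x^3,x^4)$ (a patch of spacetime), with a smooth Lorentzian metric $g_{ab}$ for which $d\tau$ is timelike and the surfaces $\Sigma_\tau=\{\tau=\mathrm{const}\}$ are spacelike; let $\mathcal G_{ab}$ be a smooth symmetric tensor field (the source in $G_{ab}=\mathcal G_{ab}$). Let $N>0$ and $n^a$ be the lapse of $\partial_\tau$ and the future unit normal of $\Sigma_\tau$, $h_{ab}=g_{ab}+n_an_b$, $K_{ab}=\tfrac12\mathcal L_nh_{ab}$, $\mathfrak p_a=-h^e{}_an^f\mathcal G_{ef}$, and $D_i$ the Levi-Civita derivative of $h_{ij}$ on $\Sigma_\tau$. In $\Sigma_\tau$ let $\hat n_i=\hat N(d\rho)_i$ ($\hat N>0$) be the unit normal of the surfaces $\mathcal S_{\tau,\rho}$ on which $\tau$ and $\rho$ are constant, $\hat\gamma_{ij}=h_{ij}-\hat n_i\hat n_j$ with Levi-Civita derivative $\hat D_i$ on $\mathcal S_{\tau,\rho}$, $\hat N^i=\hat\gamma^i{}_j(\partial_\rho)^j$, $\hat K_{ij}=\tfrac12\mathcal L_{\hat n}\hat\gamma_{ij}$,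 $\dot{\hat n}_i=\hat n^lD_l\hat n_i$, and $$\boldsymbol\kappa=\hat n^k\hat n^lK_{kl},\quad \mathbf k_i=\hat\gamma^k{}_i\hat n^lK_{kl},\quad \mathbf K_{ij}=\hat\gamma^k{}_i\hat\gamma^l{}_jK_{kl},\quad \overset{\circ}{\mathbf K}_{ij}=\mathbf K_{ij}-\tfrac12\hat\gamma_{ij}\hat\gamma^{kl}\mathbf K_{kl}.$$ Assume that the shift of $\partial_\tau$ vanishes, and that $\hat\gamma_{ij}=\Omega^2\gamma_{ij}$ with a smooth nowhere vanishing function $\Omega$ and with $\gamma^{ij}\mathcal L_\eta\gamma_{ij}=0$ on the surfaces $\mathcal S_{\tau,\rho}$ for $\eta=\partial_\tau$ and $\eta=\partial_\rho$. Capital indices take the values $3,4$ and denote components along $\mathcal S_{\tau,\rho}$. Proposition. (a) At every point of $U$ (in particular on $\Sigma_0$), the momentum constraint $$D_iK^i{}_j-D_jK^i{}_i+\mathfrak p_j=0$$ holds if and only if both of the following equations hold: $$\hat K^l{}_l\,\mathbf k_i+\hat D^l\overset{\circ}{\mathbf K}_{li}+\boldsymbol\kappa\,\dot{\hat n}_i+(2\hat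 N)^{-1}\hat\gamma_{ij}\mathcal L_{\hat n}(\mathcal L_n\hat N^j)+2\hat K_{ij}\mathbf k^j-(\mathcal L_{\hat n}\ln\hat N)\,\mathbf k_i-\dot{\hat n}^l\mathbf K_{li}-\hat D_i\boldsymbol\kappa-\tfrac12\hat D_i(\mathcal L_n\ln\Omega^2)+\mathfrak p_l\hat\gamma^l{}_i=0,\tag{1}$$ $$\boldsymbol\kappa\,\hat K^l{}_l-\mathbf K_{kl}\hat K^{kl}+(2\hat N)^{-1}\hat D_l(\mathcal L_n\hat N^l)-\mathcal L_{\hat n}(\mathcal L_n\ln\Omega^2)+\mathbf k^l\hat D_l\ln\hat N+\mathfrak p_l\hat n^l=0.\tag{2}$$ (b) In the coordinates $(\rho,x^3,x^4)$, $2$ times the left-hand side of (1) and $-2\hat N$ times that of (2) are the components of the left-hand side of $$\mathcal A^{(\rho)}\partial_\rho\mathbf u+\mathcal A^{(K)}\partial_K\mathbf u+\mathcal B=0,\qquad \mathbf u=(\mathcal L_n\hat N^B,\ \mathcal L_n\ln\Omega^2)^T,$$ $$\mathcal A^{(\rho)}=\begin{pmatrix}\hat N^{-2}\hat\gamma_{AB}&0\\0&2\end{pmatrix},\qquad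 \mathcal A^{(K)}=\begin{pmatrix}-\hat N^{-2}\hat N^K\hat\gamma_{AB}&-\delta_A{}^K\\-\delta_B{}^K&-2\hat N^K\end{pmatrix},$$ so that this system is equivalent to the momentum constraint. All coefficient matrices are symmetric and $\mathcal A^{(\rho)}$ is positive definite: the system is first order symmetric hyperbolic with $\rho$ in the role of time. (c) $\mathcal A^{(\rho)}$, $\mathcal A^{(K)}$ and $\mathcal B$ are smooth functions, the same for all such spacetimes, of $\mathbf u$ and of the following quantities defined on the surfaces $\mathcal S_{\tau,\rho}$: the fields $\Omega,\gamma_{AB},\hat N,\hat N^A,\mathcal L_n\hat N,\mathcal L_n\gamma_{AB}$ and their first derivatives $\partial_3,\partial_4$, together with $\hat K_{AB}$, $\mathcal L_{\hat n}\ln\hat N$, $\mathfrak p_A$ and $\mathfrak p_l\hat n^l$. Here smoothness is on the open set of values with $\Omega\neq0$, $\det\gamma_{AB}>0$, $\hat N>0$, and $\mathbf u$ arbitrary. -/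

import Mathlib

open scoped ContDiff

namespace FoliatedSpacetime

noncomputable section

/-! ### Tensor calculus in coordinates

Everything is written in a patch of coordinates `(τ, ρ, x³, x⁴)`; the index values
`0, 1, 2, 3 : Fin 4` stand for `τ, ρ, x³, x⁴`. -/

/-- Coordinate space of `(τ, ρ, x³, x⁴)`. -/
abbrev Pt := Fin 4 → ℝ

/-- The partial derivative `∂_a f` at `x`. -/
def pd (a : Fin 4) (f : Pt → ℝ) (x : Pt) : ℝ := fderiv ℝ f x (Pi.single a 1)

section Leaf

/- Operations on tensor fields along the leaves on which the coordinates listed by the index map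
`e : ι → Fin 4` are free and the others are constant: `e = id` for the spacetime,
`e = Fin.succ` for the surfaces `Σ_τ`, `e = idxS` for the surfaces `S_{τ,ρ}`. -/
variable {ι : Type} [Fintype ι] [DecidableEq ι] (e : ι → Fin 4)

/-- Lie derivative of a function. -/
def lieFun (X : Pt → ι → ℝ) (f : Pt → ℝ) (x : Pt) : ℝ :=
  ∑ l, X x l * pd (e l) f x

/-- Lie derivative of a vector field: `(L_X Y)^k = X^l ∂_l Y^k - Y^l ∂_l X^k`. -/
def lieVec (X Y : Pt → ι → ℝ) (x : Pt) (k : ι) : ℝ :=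
  ∑ l, (X x l * pd (e l) (fun y => Y y k) x - Y x l * pd (e l) (fun y => X y k) x)

/-- Lie derivative of a `(0,2)` tensor field:
`(L_X T)_ij = X^l ∂_l T_ij + T_lj ∂_i X^l + T_il ∂_j X^l`. -/
def lieTensor (X : Pt → ι → ℝ) (T : Pt → Matrix ι ι ℝ) (x : Pt) : Matrix ι ι ℝ :=
  Matrix.of fun i j => ∑ l, (X x l * pd (e l) (fun y => T y i j) x
    + T x l j * pd (e i) (fun y => X y l) x + T x i l * pd (e j) (fun y => X y l) x)

/-- Christoffel symbols `Γ^k_ij` of the leaf metric `q`. -/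
def christoffel (q : Pt → Matrix ι ι ℝ) (x : Pt) (k i j : ι) : ℝ :=
  (1 / 2) * ∑ l, (q x)⁻¹ k l * (pd (e i) (fun y => q y j l) x + pd (e j) (fun y => q y i l) x
    - pd (e l) (fun y => q y i j) x)

/-- Levi-Civita derivative of a covector field, `∇_i Z_j`. -/
def covCo (q : Pt → Matrix ι ι ℝ) (Z : Pt → ι → ℝ) (x : Pt) (i j : ι) : ℝ :=
  pd (e i) (fun y => Z y j) x - ∑ m, christoffel e q x m i j * Z x m

/-- Levi-Civita derivative of a vector field, `∇_i Y^k`. -/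
def covVec (q : Pt → Matrix ι ι ℝ) (Y : Pt → ι → ℝ) (x : Pt) (i k : ι) : ℝ :=
  pd (e i) (fun y => Y y k) x + ∑ m, christoffel e q x k i m * Y x m

/-- Levi-Civita derivative of a `(0,2)` tensor field, `∇_i T_jk`. -/
def covTensor (q T : Pt → Matrix ι ι ℝ) (x : Pt) (i j k : ι) : ℝ :=
  pd (e i) (fun y => T y j k) x - ∑ m, christoffel e q x m i j * T x m k
    - ∑ m, christoffel e q x m i k * T x j m

end Leaf

/-- The indices of `x³, x⁴` (capital Latin indices). -/
def idxS (A : Fin 2) : Fin 4 := A.succ.succ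

/-- Pull-back of a covariant tensor to `Σ_τ`. -/
def onSigma (T : Pt → Matrix (Fin 4) (Fin 4) ℝ) (x : Pt) : Matrix (Fin 3) (Fin 3) ℝ :=
  (T x).submatrix Fin.succ Fin.succ

/-- Pull-back of a covariant tensor to `S_{τ,ρ}`. -/
def onS (T : Pt → Matrix (Fin 4) (Fin 4) ℝ) (x : Pt) : Matrix (Fin 2) (Fin 2) ℝ :=
  (T x).submatrix idxS idxS

/-- Spatial components of a (co)vector, i.e. the pull-back of a covector to `Σ_τ`, or a vector
tangent to `Σ_τ` as a vector of `Σ_τ`. -/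
def sp (v : Pt → Fin 4 → ℝ) (x : Pt) (i : Fin 3) : ℝ := v x i.succ

/-- The components of a (co)vector along `S_{τ,ρ}`. -/
def onS₁ (v : Pt → Fin 4 → ℝ) (x : Pt) (A : Fin 2) : ℝ := v x (idxS A)

/-! ### The `1+3` decomposition -/

section Geometry

/- `g` is the spacetime metric `g_ab`, `G` the source `𝒢_ab` of Einstein's equations, `Ω` the
conformal factor. -/
variable (g G : Pt → Matrix (Fin 4) (Fin 4) ℝ) (Ω : Pt → ℝ)

/-- The lapse `N`: `g^{ab} (dτ)_a (dτ)_b = - N⁻²`. -/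
def lapse (x : Pt) : ℝ := (Real.sqrt (-((g x)⁻¹ 0 0)))⁻¹

/-- The future directed unit normal covector `n_a = - N (dτ)_a` of `Σ_τ`. -/
def normalCo (x : Pt) (a : Fin 4) : ℝ := -(lapse g x) * (Pi.single 0 1 : Fin 4 → ℝ) a

/-- `n^a`. -/
def normal (x : Pt) (a : Fin 4) : ℝ := ∑ b, (g x)⁻¹ a b * normalCo g x b

/-- `h_ab = g_ab + n_a n_b`. -/
def h (x : Pt) : Matrix (Fin 4) (Fin 4) ℝ :=
  Matrix.of fun a b => g x a b + normalCo g x a * normalCo g x b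

/-- `h^{ab} = g^{ab} + n^a n^b`. -/
def hUp (x : Pt) (a b : Fin 4) : ℝ := (g x)⁻¹ a b + normal g x a * normal g x b

/-- `h^a_b = δ^a_b + n^a n_b`. -/
def hMix (x : Pt) (a b : Fin 4) : ℝ :=
  (1 : Matrix (Fin 4) (Fin 4) ℝ) a b + normal g x a * normalCo g x b

/-- The shift `N^a = h^a_e τ^e` of `τ^a = (∂_τ)^a`. -/
def shift (x : Pt) (a : Fin 4) : ℝ := ∑ b, hMix g x a b * (Pi.single 0 1 : Fin 4 → ℝ) b

/-- The extrinsic curvature `K_ab = ½ L_n h_ab` of `Σ_τ`. -/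
def K (x : Pt) : Matrix (Fin 4) (Fin 4) ℝ := (1 / 2 : ℝ) • lieTensor id (normal g) (h g) x

/-- `𝔭_a = - h^e_a n^f 𝒢_ef`. -/
def mom (x : Pt) (a : Fin 4) : ℝ := -∑ b, ∑ c, hMix g x b a * normal g x c * G x b c

/-- The induced metric `h_ij` on `Σ_τ`. -/
abbrev h3 : Pt → Matrix (Fin 3) (Fin 3) ℝ := onSigma (h g)

/-- The left hand side of the momentum constraint on `Σ_τ`:
`D_i K^i_j - D_j K^i_i + 𝔭_j`, with `D` the Levi-Civita derivative of `h_ij`. -/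
def momentumConstraint (x : Pt) (j : Fin 3) : ℝ :=
  ∑ i, ∑ l, (h3 g x)⁻¹ i l * covTensor Fin.succ (h3 g) (onSigma (K g)) x l i j
    - pd j.succ (fun y => ∑ i, ∑ l, (h3 g y)⁻¹ i l * onSigma (K g) y i l) x
    + sp (mom g G) x j

/-! ### The `1+2` decomposition of `Σ_τ` -/

/-- The lapse `N̂` of `ρ^i = (∂_ρ)^i` on `Σ_τ`: `h^{ij} (dρ)_i (dρ)_j = N̂⁻²`. -/
def lapseHat (x : Pt) : ℝ := (Real.sqrt (hUp g x 1 1))⁻¹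

/-- The unit normal covector `n̂_i = N̂ (dρ)_i` of `S_{τ,ρ}` in `Σ_τ`. -/
def nHatCo (x : Pt) (a : Fin 4) : ℝ := lapseHat g x * (Pi.single 1 1 : Fin 4 → ℝ) a

/-- `n̂^i`. -/
def nHat (x : Pt) (a : Fin 4) : ℝ := ∑ b, hUp g x a b * nHatCo g x b

/-- `γ̂_ij = h_ij - n̂_i n̂_j`. -/
def gammaHat (x : Pt) : Matrix (Fin 4) (Fin 4) ℝ :=
  Matrix.of fun a b => h g x a b - nHatCo g x a * nHatCo g x b

/-- `γ̂^{ij} = h^{ij} - n̂^i n̂^j`. -/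
def gammaHatUp (x : Pt) (a b : Fin 4) : ℝ := hUp g x a b - nHat g x a * nHat g x b

/-- `γ̂^i_j = h^i_j - n̂^i n̂_j`. -/
def gammaHatMix (x : Pt) (a b : Fin 4) : ℝ := hMix g x a b - nHat g x a * nHatCo g x b

/-- The shift `N̂^i = γ̂^i_j ρ^j` of `ρ^i = (∂_ρ)^i` on `Σ_τ`. -/
def shiftHat (x : Pt) (a : Fin 4) : ℝ :=
  ∑ b, gammaHatMix g x a b * (Pi.single 1 1 : Fin 4 → ℝ) b

/-- The induced metric `γ̂_AB` on `S_{τ,ρ}`. -/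
abbrev gammaHatS : Pt → Matrix (Fin 2) (Fin 2) ℝ := onS (gammaHat g)

/-- `κ = n̂^k n̂^l K_kl`. -/
def kappa (x : Pt) : ℝ := ∑ a, ∑ b, nHat g x a * nHat g x b * K g x a b

/-- The covector `k_i = γ̂^k_i n̂^l K_kl`. -/
def kCo (x : Pt) (i : Fin 4) : ℝ := ∑ a, ∑ b, gammaHatMix g x a i * nHat g x b * K g x a b

/-- The bold `K_ij = γ̂^k_i γ̂^l_j K_kl`. -/
def KS (x : Pt) : Matrix (Fin 4) (Fin 4) ℝ :=
  Matrix.of fun i j => ∑ a, ∑ b, gammaHatMix g x a i * gammaHatMix g x b j * K g x a b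

/-- The trace free part `(γ̂^k_i γ̂^l_j - ½ γ̂_ij γ̂^{kl}) K_kl`. -/
def KTF (x : Pt) : Matrix (Fin 4) (Fin 4) ℝ :=
  Matrix.of fun i j => ∑ a, ∑ b, (gammaHatMix g x a i * gammaHatMix g x b j
    - 1 / 2 * gammaHat g x i j * gammaHatUp g x a b) * K g x a b

/-- The extrinsic curvature `K̂_ij = ½ L_n̂ γ̂_ij` of `S_{τ,ρ}` in `Σ_τ`. -/
def KHat (x : Pt) : Matrix (Fin 3) (Fin 3) ℝ :=
  (1 / 2 : ℝ) • lieTensor Fin.succ (sp (nHat g)) (onSigma (gammaHat g)) x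

/-- `K̂_AB`. -/
def KHatS (x : Pt) (A B : Fin 2) : ℝ := KHat g x A.succ B.succ

/-- The trace `K̂^l_l`. -/
def trKHat (x : Pt) : ℝ := ∑ A, ∑ B, (gammaHatS g x)⁻¹ A B * KHatS g x A B

/-- `n̂^l D_l n̂_i` on `Σ_τ`. -/
def nHatDot (x : Pt) (i : Fin 3) : ℝ :=
  ∑ l, sp (nHat g) x l * covCo Fin.succ (h3 g) (sp (nHatCo g)) x l i

/-- `L_n N̂^i`. -/
def lieShift : Pt → Fin 4 → ℝ := lieVec id (normal g) (shiftHat g)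

/-- `L_n ln Ω²`. -/
def lieLogOmega : Pt → ℝ := lieFun id (normal g) (fun y => Real.log (Ω y ^ 2))

/-- `L_n̂ ln N̂`. -/
def lieLogLapseHat : Pt → ℝ :=
  lieFun Fin.succ (sp (nHat g)) (fun y => Real.log (lapseHat g y))

/-- `γ_ij`, defined by `γ̂_ij = Ω² γ_ij`. -/
def gammaConf (x : Pt) : Matrix (Fin 4) (Fin 4) ℝ := (Ω x ^ 2)⁻¹ • gammaHat g x

/-- The standing assumptions, on an open set `U` of coordinate space: `g` is a smooth Lorentzian
metric for which `dτ` is timelike and the `Σ_τ` are spacelike, `G` is a smooth symmetric tensor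
field, the shift of `τ^a` vanishes, and `Ω` is a smooth nowhere vanishing function such that
`γ_ij = Ω⁻² γ̂_ij` satisfies `γ^{ij} L_η γ_ij = 0` on the `S_{τ,ρ}` for `η = ∂_τ` and `η = ∂_ρ`. -/
structure IsAdapted (U : Set Pt) : Prop where
  isOpen : IsOpen U
  smooth_metric : ∀ a b, ContDiffOn ℝ ∞ (fun x => g x a b) U
  symm_metric : ∀ x ∈ U, (g x).IsSymm
  timelike : ∀ x ∈ U, (g x)⁻¹ 0 0 < 0
  spacelike : ∀ x ∈ U, (onSigma g x).PosDef
  smooth_source : ∀ a b, ContDiffOn ℝ ∞ (fun x => G x a b) U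
  symm_source : ∀ x ∈ U, (G x).IsSymm
  shift_eq_zero : ∀ x ∈ U, ∀ a, shift g x a = 0
  smooth_conf : ContDiffOn ℝ ∞ Ω U
  conf_ne_zero : ∀ x ∈ U, Ω x ≠ 0
  trace_free : ∀ x ∈ U, ∀ η : Fin 4, η = 0 ∨ η = 1 →
    ∑ A, ∑ B, (onS (gammaConf g Ω) x)⁻¹ A B *
      onS (lieTensor id (fun _ => Pi.single η 1) (gammaConf g Ω)) x A B = 0

/-! ### The two projected equations

The left hand side of the first one annihilates `n̂^i`, so that the equation is the same as its
pull-back to `S_{τ,ρ}`; `D̂` is the Levi-Civita derivative of `γ̂_AB` on `S_{τ,ρ}`, and capital indices are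
raised with `γ̂^{AB}`. -/

/-- The left hand side, pulled back to `S_{τ,ρ}`, of
`K̂^l_l k_i + D̂^l K°_li + κ n̂̇_i + (2N̂)⁻¹ γ̂_ij [L_n̂ (L_n N̂)]^j + 2 K̂_ij k^j - L_n̂(ln N̂) k_i
- n̂̇^l K_li - D̂_i κ - ½ D̂_i (L_n ln Ω²) + 𝔭_l γ̂^l_i = 0`. -/
def parConst (x : Pt) (A : Fin 2) : ℝ :=
  trKHat g x * onS₁ (kCo g) x A
    + ∑ B, ∑ C, (gammaHatS g x)⁻¹ B C * covTensor idxS (gammaHatS g) (onS (KTF g)) x B C A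
    + kappa g x * nHatDot g x A.succ
    + (2 * lapseHat g x)⁻¹ * ∑ j : Fin 3, onSigma (gammaHat g) x A.succ j *
        lieVec Fin.succ (sp (nHat g)) (sp (lieShift g)) x j
    + 2 * ∑ B, ∑ C, KHatS g x A B * (gammaHatS g x)⁻¹ B C * onS₁ (kCo g) x C
    - lieLogLapseHat g x * onS₁ (kCo g) x A
    - ∑ B, ∑ C, nHatDot g x B.succ * (gammaHatS g x)⁻¹ B C * onS (KS g) x C A
    - pd (idxS A) (kappa g) x
    - 1 / 2 * pd (idxS A) (lieLogOmega g Ω) x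
    + ∑ l, mom g G x l * gammaHatMix g x l (idxS A)

/-- The left hand side of
`κ K̂^l_l - K_kl K̂^kl + (2N̂)⁻¹ D̂_l (L_n N̂^l) - L_n̂(L_n ln Ω²) + k^l D̂_l ln N̂ + 𝔭_l n̂^l = 0`. -/
def ortConst (x : Pt) : ℝ :=
  kappa g x * trKHat g x
    - ∑ A, ∑ B, ∑ C, ∑ D, (gammaHatS g x)⁻¹ A C * (gammaHatS g x)⁻¹ B D *
        onS (KS g) x A B * KHatS g x C D
    + (2 * lapseHat g x)⁻¹ * ∑ A, covVec idxS (gammaHatS g) (onS₁ (lieShift g)) x A A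
    - lieFun Fin.succ (sp (nHat g)) (lieLogOmega g Ω) x
    + ∑ A, ∑ B, (gammaHatS g x)⁻¹ A B * onS₁ (kCo g) x A *
        pd (idxS B) (fun y => Real.log (lapseHat g y)) x
    + ∑ l, mom g G x l * nHat g x l

/-! ### The first order system -/

/-- Index set of the unknown: two components `L_n N̂^B` and one component `L_n ln Ω²`. -/
abbrev Comp := Fin 2 ⊕ Unit

/-- The unknown `u = (L_n N̂^B, L_n ln Ω²)`. -/
def unknown (x : Pt) : Comp → ℝ :=
  Sum.elim (fun B => onS₁ (lieShift g) x B) (fun _ => lieLogOmega g Ω x)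

/-- Values of `(Ω, γ_AB, N̂, N̂^A, L_n N̂, L_n γ_AB)` at a point. -/
abbrev SurfaceFields :=
  ℝ × (Fin 2 → Fin 2 → ℝ) × ℝ × (Fin 2 → ℝ) × ℝ × (Fin 2 → Fin 2 → ℝ)

/-- Values at a point of the fields on the surfaces `S_{τ,ρ}` on which the system may depend: the
fields `(Ω, γ_AB, N̂, N̂^A, L_n N̂, L_n γ_AB)`, their two derivatives `∂_3, ∂_4` tangential to
`S_{τ,ρ}`, and `K̂_AB`, `L_n̂ ln N̂`, `𝔭_A`, `𝔭_l n̂^l`. -/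
abbrev SurfaceData :=
  SurfaceFields × (Fin 2 → SurfaceFields) × (Fin 2 → Fin 2 → ℝ) × ℝ × (Fin 2 → ℝ) × ℝ

/-- The fields `(Ω, γ_AB, N̂, N̂^A, L_n N̂, L_n γ_AB)`. -/
def surfaceFields (x : Pt) : SurfaceFields :=
  (Ω x, fun A B => onS (gammaConf g Ω) x A B, lapseHat g x, fun A => onS₁ (shiftHat g) x A,
    lieFun id (normal g) (lapseHat g) x,
    fun A B => onS (lieTensor id (normal g) (gammaConf g Ω)) x A B)

/-- Their partial derivatives `∂_C`, `C = 3, 4`. -/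
def surfaceFieldsDeriv (x : Pt) (C : Fin 2) : SurfaceFields :=
  (pd (idxS C) Ω x, fun A B => pd (idxS C) (fun y => onS (gammaConf g Ω) y A B) x,
    pd (idxS C) (lapseHat g) x, fun A => pd (idxS C) (fun y => onS₁ (shiftHat g) y A) x,
    pd (idxS C) (lieFun id (normal g) (lapseHat g)) x,
    fun A B => pd (idxS C)
      (fun y => onS (lieTensor id (normal g) (gammaConf g Ω)) y A B) x)

/-- All the data of a spacetime at the point `x` on which the system may depend. -/
def surfaceData (x : Pt) : SurfaceData :=
  (surfaceFields g Ω x, surfaceFieldsDeriv g Ω x, KHatS g x, lieLogLapseHat g x,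
    onS₁ (mom g G) x, ∑ l, mom g G x l * nHat g x l)

end Geometry

namespace SurfaceData

/-- The entry `Ω`. -/
def conf (q : SurfaceData) : ℝ := q.1.1

/-- The entry `γ_AB`. -/
def gamma (q : SurfaceData) : Matrix (Fin 2) (Fin 2) ℝ := Matrix.of q.1.2.1

/-- The entry `N̂`. -/
def lapse (q : SurfaceData) : ℝ := q.1.2.2.1

/-- The entry `N̂^A`. -/
def shift (q : SurfaceData) : Fin 2 → ℝ := q.1.2.2.2.1

end SurfaceData

/-- The open set of admissible data: `Ω ≠ 0`, `γ_AB` of positive determinant, `N̂ > 0`. -/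
def admissible : Set SurfaceData :=
  {q | SurfaceData.conf q ≠ 0 ∧ 0 < (SurfaceData.gamma q).det ∧ 0 < SurfaceData.lapse q}

/-- The coefficient of `∂_ρ`: the block matrix with rows `(N̂⁻² γ̂_AB, 0)` and `(0, 2)`, where
`γ̂_AB = Ω² γ_AB`. -/
def coeffRho (q : SurfaceData) : Matrix Comp Comp ℝ :=
  Matrix.fromBlocks
    (((SurfaceData.lapse q) ^ 2)⁻¹ • ((SurfaceData.conf q) ^ 2 • SurfaceData.gamma q)) 0
    0 (Matrix.of fun _ _ => 2)

/-- The coefficient of `∂_K`: the block matrix with rows `(- N̂^K N̂⁻² γ̂_AB, - δ_A^K)` and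
`(- δ_B^K, - 2 N̂^K)`. -/
def coeffTan (q : SurfaceData) (k : Fin 2) : Matrix Comp Comp ℝ :=
  Matrix.fromBlocks
    (-((SurfaceData.shift q k / (SurfaceData.lapse q) ^ 2) •
      ((SurfaceData.conf q) ^ 2 • SurfaceData.gamma q)))
    (Matrix.of fun A _ => -(1 : Matrix (Fin 2) (Fin 2) ℝ) A k)
    (Matrix.of fun _ B => -(1 : Matrix (Fin 2) (Fin 2) ℝ) B k)
    (Matrix.of fun _ _ => -(2 * SurfaceData.shift q k))

/-- The left hand side of the first order system
`A^(ρ) ∂_ρ u + A^(K) ∂_K u + B = 0` with the source term `B = B(q, u)`. -/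
def system (B : SurfaceData × (Comp → ℝ) → Comp → ℝ) (q : Pt → SurfaceData)
    (u : Pt → Comp → ℝ) (x : Pt) : Comp → ℝ :=
  (coeffRho (q x)).mulVec (fun c => pd 1 (fun y => u y c) x)
    + ∑ k, (coeffTan (q x) k).mulVec (fun c => pd (idxS k) (fun y => u y c) x)
    + B (q x, u x)

/-- A first order system with coefficient `A₀` of the time derivative and `A k` of the spatial
derivatives is symmetric hyperbolic at a point if all coefficients are symmetric and `A₀` is
positive definite. -/
def IsSymmetricHyperbolic (A₀ : Matrix Comp Comp ℝ) (A : Fin 2 → Matrix Comp Comp ℝ) : Prop :=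
  A₀.IsSymm ∧ (∀ k, (A k).IsSymm) ∧ A₀.PosDef

end

end FoliatedSpacetime

open FoliatedSpacetime

namespace FoliatedSpacetime

/-! ### Partial derivatives of smooth functions on an open set -/

section Calculus

variable {U : Set Pt} {f k : Pt → ℝ} {x : Pt}

/-! Vanishing shift makes g block diagonal, so n = N⁻¹∂_τ, and on components tangent to Σ_τ the Lie
derivatives along n that occur here are N⁻¹∂_τ. Put m = ∂_ρ - N̂^A ∂_A, so that n̂ = N̂⁻¹ m.
Throughout U one has h(m, ∂_A) = 0, h(m, m) = N̂² and h⁻¹ = N̂⁻² m⊗m + γ̂⁻¹. Differentiating the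
first two identities in τ gives k_A = (2N̂)⁻¹ γ̂_AB L_n N̂^B and κ = L_n ln N̂ (`kT_eq`, `kCo_eq`,
`kappa_eq_conf`). The trace condition for ∂_τ gives L_n ln Ω² for the trace of the tangential part
of K and ½Ω² L_n γ for its trace free part (`trace_K3`, `KTF_eq_conf`). Hence the mixed part and the
tangential trace of K carry the unknowns, while κ and the trace free part are data.

For symmetric K the divergence is a polynomial in the inverse metric, K and first derivatives
(`divForm`). Differentiating the same frame identities along Σ_τ (`frameJets`) and inserting the
split inverse metric gives its components along ∂_A and m (`divForm_tangential`, `divForm_normal`).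
The derivatives m(N̂^A) of the shift cancel; those of γ̂_AB enter only through K̂_AB, and those of
N̂ only through L_n̂ ln N̂. Next subtract the gradient of tr K = κ + L_n ln Ω². Along m the two
copies of m(κ) cancel and -m(L_n ln Ω²) remains. Along ∂_A the divergence of the pure trace part
contributes +½∂_A(L_n ln Ω²), so -½ of this gradient remains. The results are the two projected
equations (`momentumConstraint_tangential`, `momentumConstraint_normal`), equivalent to the
constraint because m, ∂_3, ∂_4 is a frame.

The coupling between the unknowns is -½∂_A(L_n ln Ω²) in one equation and (2N̂)⁻¹∂_A(L_n N̂^A) in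
the other. The factors 2 and -2N̂ turn both coefficients into -1, which is the symmetry, and they
make the ρ-coefficient the positive matrix with blocks N̂⁻²γ̂ and 2. All other terms form one
explicit expression `source`, whose only denominators are N̂ and det γ̂. -/

theorem differentiableAt_of_smooth (hU : IsOpen U) (hx : x ∈ U) (hf : ContDiffOn ℝ ∞ f U) :
    DifferentiableAt ℝ f x :=
  (hf.contDiffAt (hU.mem_nhds hx)).differentiableAt (by simp)

/-- Since U is open, an identity on U holds near x. This permits differentiating the adapted
formulas below, which are valid only on U. -/
theorem pd_congr (hU : IsOpen U) (hx : x ∈ U) (hfk : ∀ y ∈ U, f y = k y) (a : Fin 4) :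
    pd a f x = pd a k x := by
  have : f =ᶠ[nhds x] k := Filter.eventuallyEq_of_mem (hU.mem_nhds hx) hfk
  simp only [pd, this.fderiv_eq]

theorem pd_const (c : ℝ) (a : Fin 4) : pd a (fun _ => c) x = 0 := by
  simp [pd]

theorem pd_eq_zero (hU : IsOpen U) (hx : x ∈ U) {c : ℝ} (hf : ∀ y ∈ U, f y = c) (a : Fin 4) :
    pd a f x = 0 := by
  rw [pd_congr hU hx hf, pd_const]

theorem pd_add (hf : DifferentiableAt ℝ f x) (hk : DifferentiableAt ℝ k x) (a : Fin 4) :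
    pd a (fun y => f y + k y) x = pd a f x + pd a k x := by
  simp [pd, fderiv_fun_add hf hk]

theorem pd_sub (hf : DifferentiableAt ℝ f x) (hk : DifferentiableAt ℝ k x) (a : Fin 4) :
    pd a (fun y => f y - k y) x = pd a f x - pd a k x := by
  simp [pd, fderiv_fun_sub hf hk]

theorem pd_neg (a : Fin 4) : pd a (fun y => -f y) x = -pd a f x := by
  simp [pd, fderiv_fun_neg]

theorem pd_mul (hf : DifferentiableAt ℝ f x) (hk : DifferentiableAt ℝ k x) (a : Fin 4) :
    pd a (fun y => f y * k y) x = pd a f x * k x + f x * pd a k x := by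
  simp [pd, fderiv_fun_mul hf hk]; ring

theorem pd_const_mul (c : ℝ) (hf : DifferentiableAt ℝ f x) (a : Fin 4) :
    pd a (fun y => c * f y) x = c * pd a f x := by
  rw [pd_mul (differentiableAt_const c) hf, pd_const]; ring

theorem pd_inv (hf : DifferentiableAt ℝ f x) (h0 : f x ≠ 0) (a : Fin 4) :
    pd a (fun y => (f y)⁻¹) x = -(pd a f x / f x ^ 2) := by
  have := ((hasDerivAt_inv h0).comp_hasFDerivAt x hf.hasFDerivAt).fderiv
  simp only [pd]
  rw [show (fun y => (f y)⁻¹) = Inv.inv ∘ f from rfl, this]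
  simp; ring

theorem pd_log (hf : DifferentiableAt ℝ f x) (h0 : f x ≠ 0) (a : Fin 4) :
    pd a (fun y => Real.log (f y)) x = pd a f x / f x := by
  simp only [pd]
  rw [(hf.hasFDerivAt.log h0).fderiv]
  simp; ring

theorem pd_sum {ι : Type} (s : Finset ι) {F : ι → Pt → ℝ}
    (hF : ∀ i ∈ s, DifferentiableAt ℝ (F i) x) (a : Fin 4) :
    pd a (fun y => ∑ i ∈ s, F i y) x = ∑ i ∈ s, pd a (F i) x := by
  simp [pd, fderiv_fun_sum hF]

theorem smooth_pd (hU : IsOpen U) (hf : ContDiffOn ℝ ∞ f U) (a : Fin 4) :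
    ContDiffOn ℝ ∞ (pd a f) U := by
  have h1 : ContDiffOn ℝ ∞ (fun y => fderiv ℝ f y) U :=
    hf.fderiv_of_isOpen hU (by simp)
  exact h1.clm_apply contDiffOn_const

end Calculus

/-! ### Smoothness of determinants and inverse matrices -/

section MatrixSmooth

variable {E : Type*} [NormedAddCommGroup E] [NormedSpace ℝ E] {U : Set E}
variable {ι : Type*} [Fintype ι] [DecidableEq ι] {M : E → Matrix ι ι ℝ}

theorem smooth_det (hM : ∀ i j, ContDiffOn ℝ ∞ (fun y => M y i j) U) :
    ContDiffOn ℝ ∞ (fun y => (M y).det) U := by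
  simp only [Matrix.det_apply']
  exact ContDiffOn.sum fun σ _ => contDiffOn_const.mul (contDiffOn_prod fun i _ => hM _ _)

/-- Cramer's rule: an adjugate entry is the determinant of the matrix with one row replaced by a
constant one. -/
theorem smooth_matrix_inv (hM : ∀ i j, ContDiffOn ℝ ∞ (fun y => M y i j) U)
    (h0 : ∀ y ∈ U, (M y).det ≠ 0) (i j : ι) : ContDiffOn ℝ ∞ (fun y => (M y)⁻¹ i j) U := by
  have hadj : ContDiffOn ℝ ∞ (fun y => (M y).adjugate i j) U := by
    simp only [Matrix.adjugate_apply]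
    refine smooth_det fun k l => ?_
    by_cases hk : k = j
    · subst hk
      simpa using contDiffOn_const
    · simpa [Matrix.updateRow_ne hk] using hM k l
  have : (fun y => (M y)⁻¹ i j) = fun y => ((M y).det)⁻¹ * (M y).adjugate i j := by
    funext y
    simp [Matrix.inv_def]
  rw [this]
  exact ((smooth_det hM).inv h0).mul hadj

end MatrixSmooth

end FoliatedSpacetime

namespace FoliatedSpacetime

/-! ### Algebra of divergences of symmetric tensors -/

section Algebra

variable {ι : Type} [Fintype ι]

/-- The contraction `H^{il} (∂_l h_ip - ½ ∂_p h_il)` of the Christoffel symbols, lowered. -/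
noncomputable def gammaTrace (H : ι → ι → ℝ) (dh : ι → ι → ι → ℝ) (p : ι) : ℝ :=
  ∑ i, ∑ l, H i l * (dh l i p - 1 / 2 * dh p i l)

/-- The divergence `∇^i K_ij` in terms of the inverse metric `H`, the derivatives `dh` of the
metric, the components of `K` and their derivatives `dK`. -/
noncomputable def divForm (H K : ι → ι → ℝ) (dh dK : ι → ι → ι → ℝ) (j : ι) : ℝ :=
  ∑ i, ∑ l, H i l * dK l i j - ∑ p, (∑ i, H p i * K i j) * gammaTrace H dh p
    - 1 / 2 * ∑ l, ∑ p, (∑ i, ∑ k, H l i * K i k * H k p) * dh j l p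

/-- In the last Christoffel term, K^{lp} is symmetric, so the part of ∂_l h_jp + ∂_j h_lp - ∂_p h_lj
antisymmetric in l, p drops out and only ½K^{lp}∂_j h_lp survives. -/
theorem contract_cov_eq_divForm_three (H K : Fin 3 → Fin 3 → ℝ) (dh dK : Fin 3 → Fin 3 → Fin 3 → ℝ)
    (hH : ∀ i j, H i j = H j i) (hK : ∀ i j, K i j = K j i)
    (hdh : ∀ l i j, dh l i j = dh l j i) (j : Fin 3) :
    ∑ i, ∑ l, H i l * (dK l i j
      - ∑ m, (1 / 2 * ∑ p, H m p * (dh l i p + dh i l p - dh p l i)) * K m j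
      - ∑ m, (1 / 2 * ∑ p, H m p * (dh l j p + dh j l p - dh p l j)) * K i m)
      = divForm H K dh dK j := by
  have a1 := fun l => hdh l 1 0
  have a2 := fun l => hdh l 2 0
  have a3 := fun l => hdh l 2 1
  simp only [divForm, gammaTrace, Fin.sum_univ_three]
  simp only [hH 1 0, hH 2 0, hH 2 1, hK 1 0, hK 2 0, hK 2 1, a1, a2, a3]
  rw [hdh 0 j 0, hdh 1 j 0, hdh 2 j 0, hdh 0 j 1, hdh 1 j 1, hdh 2 j 1, hdh 0 j 2, hdh 1 j 2,
    hdh 2 j 2]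
  ring

theorem contract_cov_eq_divForm_two (H K : Fin 2 → Fin 2 → ℝ) (dh dK : Fin 2 → Fin 2 → Fin 2 → ℝ)
    (hH : ∀ i j, H i j = H j i) (hK : ∀ i j, K i j = K j i)
    (hdh : ∀ l i j, dh l i j = dh l j i) (j : Fin 2) :
    ∑ i, ∑ l, H i l * (dK l i j
      - ∑ m, (1 / 2 * ∑ p, H m p * (dh l i p + dh i l p - dh p l i)) * K m j
      - ∑ m, (1 / 2 * ∑ p, H m p * (dh l j p + dh j l p - dh p l j)) * K i m)
      = divForm H K dh dK j := by
  have a1 := fun l => hdh l 1 0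
  simp only [divForm, gammaTrace, Fin.sum_univ_two]
  simp only [hH 1 0, hK 1 0, a1]
  rw [hdh 0 j 0, hdh 1 j 0, hdh 0 j 1, hdh 1 j 1]
  ring

/-! ### Divergences in the frame m, ∂_3, ∂_4 -/

/-- The components of the inverse of a metric on `Σ_τ` in terms of the vector
`m = ∂_ρ - N̂^A ∂_A`, of `iL = N̂⁻²` and of the inverse metric `Q` of `S_{τ,ρ}`. -/
structure IsSplit (iL : ℝ) (m : Fin 3 → ℝ) (Q : Fin 2 → Fin 2 → ℝ) (H : Fin 3 → Fin 3 → ℝ) :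
    Prop where
  m_zero : m 0 = 1
  zero_zero : H 0 0 = iL
  zero_succ : ∀ A : Fin 2, H 0 A.succ = iL * m A.succ
  succ_zero : ∀ A : Fin 2, H A.succ 0 = iL * m A.succ
  succ_succ : ∀ A B : Fin 2, H A.succ B.succ = iL * m A.succ * m B.succ + Q A B
  symm : ∀ A B, Q A B = Q B A

/-- Each inverse metric is replaced by iL m⊗m + Q. The result is grouped so that m contracts
directly with K, `dK` or `dh`, where `FrameJets` supplies the values. -/
theorem divForm_split {iL : ℝ} {m : Fin 3 → ℝ} {Q : Fin 2 → Fin 2 → ℝ}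
    {H : Fin 3 → Fin 3 → ℝ} (hS : IsSplit iL m Q H) (K : Fin 3 → Fin 3 → ℝ)
    (dh dK : Fin 3 → Fin 3 → Fin 3 → ℝ)
    (hK : ∀ i j, K i j = K j i) (hdh : ∀ l i j, dh l i j = dh l j i) (j : Fin 3) :
    divForm H K dh dK j =
      iL * ∑ l, m l * (∑ i, m i * dK l i j) + ∑ A, ∑ B, Q A B * dK B.succ A.succ j
      - iL * (∑ i, m i * K i j) * (∑ p, m p * gammaTrace H dh p)
      - ∑ A, ∑ B, Q A B * K B.succ j * gammaTrace H dh A.succ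
      - 1 / 2 * (iL ^ 2 * (∑ i, m i * ∑ l, m l * K i l) * (∑ i, m i * ∑ l, m l * dh j i l)
        + 2 * iL * ∑ A, ∑ B, Q A B * (∑ i, m i * K i A.succ) * (∑ i, m i * dh j i B.succ)
        + ∑ A, ∑ B, (∑ C, ∑ D, Q A C * K C.succ D.succ * Q D B) * dh j A.succ B.succ) := by
  have s0 : (Fin.succ (0 : Fin 2)) = 1 := rfl
  have s1 : (Fin.succ (1 : Fin 2)) = 2 := rfl
  have b1 := hS.zero_succ 0; have b2 := hS.zero_succ 1
  have b3 := hS.succ_zero 0; have b4 := hS.succ_zero 1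
  have c1 := hS.succ_succ 0 0; have c2 := hS.succ_succ 0 1
  have c3 := hS.succ_succ 1 0; have c4 := hS.succ_succ 1 1
  rw [hS.symm 1 0] at c3
  simp only [s0, s1] at b1 b2 b3 b4 c1 c2 c3 c4
  unfold divForm
  generalize gammaTrace H dh = V at *
  simp only [Fin.sum_univ_three, Fin.sum_univ_two, s0, s1]
  simp only [hS.m_zero, hS.zero_zero, b1, b2, b3, b4, c1, c2, c3, c4, hS.symm 1 0, hK 1 0,
    hK 2 0, hK 2 1, hdh j 1 0, hdh j 2 0, hdh j 2 1]
  ring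

theorem gammaTrace_split {iL : ℝ} {m : Fin 3 → ℝ} {Q : Fin 2 → Fin 2 → ℝ}
    {H : Fin 3 → Fin 3 → ℝ} (hS : IsSplit iL m Q H) (dh : Fin 3 → Fin 3 → Fin 3 → ℝ)
    (p : Fin 3) :
    gammaTrace H dh p =
      iL * (∑ l, m l * (∑ i, m i * dh l i p) - 1 / 2 * ∑ i, m i * ∑ l, m l * dh p i l)
      + ∑ A, ∑ B, Q A B * (dh B.succ A.succ p - 1 / 2 * dh p A.succ B.succ) := by
  have s0 : (Fin.succ (0 : Fin 2)) = 1 := rfl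
  have s1 : (Fin.succ (1 : Fin 2)) = 2 := rfl
  have b1 := hS.zero_succ 0; have b2 := hS.zero_succ 1
  have b3 := hS.succ_zero 0; have b4 := hS.succ_zero 1
  have c1 := hS.succ_succ 0 0; have c2 := hS.succ_succ 0 1
  have c3 := hS.succ_succ 1 0; have c4 := hS.succ_succ 1 1
  simp only [s0, s1] at b1 b2 b3 b4 c1 c2 c3 c4
  simp only [gammaTrace, Fin.sum_univ_three, Fin.sum_univ_two, s0, s1]
  simp only [hS.m_zero, hS.zero_zero, b1, b2, b3, b4, c1, c2, c3, c4]
  ring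

/-- First derivatives of a metric and of a symmetric tensor on `Σ_τ`, in the frame
`m = ∂_ρ - N̂^A ∂_A`, `∂_3`, `∂_4`. -/
structure FrameJets (L κ : ℝ) (m : Fin 3 → ℝ) (kt : Fin 2 → ℝ) (K : Fin 3 → Fin 3 → ℝ)
    (dh dK : Fin 3 → Fin 3 → Fin 3 → ℝ) (dL dκ : Fin 3 → ℝ) (E F dkt : Fin 3 → Fin 2 → ℝ) :
    Prop where
  metric_symm : ∀ l i j, dh l i j = dh l j i
  tensor_symm : ∀ i j, K i j = K j i
  deriv_symm : ∀ l i j, dK l i j = dK l j i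
  dh_mixed : ∀ l (B : Fin 2), ∑ i, m i * dh l i B.succ = E l B
  dh_normal : ∀ l, ∑ i, m i * ∑ j, m j * dh l i j = 2 * L * dL l
  mixed : ∀ B : Fin 2, ∑ i, m i * K i B.succ = kt B
  normal : ∑ i, m i * ∑ j, m j * K i j = L ^ 2 * κ
  dK_mixed : ∀ l (A : Fin 2),
    ∑ i, m i * dK l i A.succ = dkt l A + ∑ B, F l B * K B.succ A.succ
  dK_normal : ∀ l, ∑ i, m i * ∑ j, m j * dK l i j
    = 2 * L * dL l * κ + L ^ 2 * dκ l + 2 * ∑ B, F l B * kt B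

/-- The extrinsic curvature of `S_{τ,ρ}` in terms of the derivative `Dq` of its metric along
`m` and of the lowered derivatives `E` of the shift. -/
noncomputable def hatK (L : ℝ) (m : Fin 3 → ℝ) (dh : Fin 3 → Fin 3 → Fin 3 → ℝ)
    (E : Fin 3 → Fin 2 → ℝ) (A B : Fin 2) : ℝ :=
  1 / 2 * L⁻¹ * (∑ l, m l * dh l A.succ B.succ - E A.succ B - E B.succ A)

section Frame

variable {L κ : ℝ} {m : Fin 3 → ℝ} {Q : Fin 2 → Fin 2 → ℝ} {H K : Fin 3 → Fin 3 → ℝ}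
  {dh dK : Fin 3 → Fin 3 → Fin 3 → ℝ} {dL dκ : Fin 3 → ℝ} {kt : Fin 2 → ℝ}
  {E F dkt : Fin 3 → Fin 2 → ℝ}

theorem gammaTrace_succ (hL : L ≠ 0) (hS : IsSplit (L ^ 2)⁻¹ m Q H)
    (hJ : FrameJets L κ m kt K dh dK dL dκ E F dkt) (C : Fin 2) :
    gammaTrace H dh C.succ = (L ^ 2)⁻¹ * ∑ l, m l * E l C - dL C.succ / L
      + gammaTrace Q (fun A B C => dh A.succ B.succ C.succ) C := by
  rw [gammaTrace_split hS]
  simp only [hJ.dh_mixed, hJ.dh_normal, gammaTrace]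
  field_simp

/-- The triple contraction of `dh` with m gives 2L m(L), of which half is removed by the -½ term.
The surface part is, up to the factor -L, the trace of `hatK`. -/
theorem gammaTrace_normal (hL : L ≠ 0) (hS : IsSplit (L ^ 2)⁻¹ m Q H)
    (hJ : FrameJets L κ m kt K dh dK dL dκ E F dkt) :
    ∑ p, m p * gammaTrace H dh p = (∑ l, m l * dL l) / L
      - L * ∑ A, ∑ B, Q A B * hatK L m dh E A B := by
  have e : ∀ p, gammaTrace H dh p =
      (L ^ 2)⁻¹ * (∑ l, m l * (∑ i, m i * dh l i p)) - dL p / L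
      + ∑ A, ∑ B, Q A B * (dh B.succ A.succ p - 1 / 2 * dh p A.succ B.succ) := by
    intro p
    rw [gammaTrace_split hS, hJ.dh_normal]
    field_simp
  have e1 : ∑ p, m p * ∑ l, m l * (∑ i, m i * dh l i p) = 2 * L * ∑ l, m l * dL l := by
    have := fun l => hJ.dh_normal l
    have h0 := this 0; have h1 := this 1; have h2 := this 2
    simp only [Fin.sum_univ_three] at h0 h1 h2 ⊢
    linear_combination m 0 * h0 + m 1 * h1 + m 2 * h2
  have e2 : ∑ p, m p * ∑ A : Fin 2, ∑ B : Fin 2,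
      Q A B * (dh B.succ A.succ p - 1 / 2 * dh p A.succ B.succ)
      = - (L * ∑ A, ∑ B, Q A B * hatK L m dh E A B) := by
    have t : ∀ A B : Fin 2, L * hatK L m dh E A B
        = 1 / 2 * (∑ l, m l * dh l A.succ B.succ - E A.succ B - E B.succ A) := by
      intro A B; unfold hatK; field_simp
    have t2 : L * ∑ A, ∑ B, Q A B * hatK L m dh E A B
        = ∑ A, ∑ B, Q A B * (L * hatK L m dh E A B) := by
      simp only [Finset.mul_sum]
      exact Finset.sum_congr rfl fun _ _ => Finset.sum_congr rfl fun _ _ => by ring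
    rw [t2]
    -- The lowered shift derivatives inside `hatK` are turned back into contractions of `dh` with m,
    -- so both sides are polynomials in the same derivatives.
    simp only [t, ← hJ.dh_mixed]
    simp only [Fin.sum_univ_three, Fin.sum_univ_two]
    have s1 := fun l => hJ.metric_symm l 1 0
    have s2 := fun l => hJ.metric_symm l 2 0
    have s3 := fun l => hJ.metric_symm l 2 1
    have s0 : (Fin.succ (0 : Fin 2)) = 1 := rfl
    have s0' : (Fin.succ (1 : Fin 2)) = 2 := rfl
    simp only [s0, s0', s1, s2, s3, hS.symm 1 0]
    ring
  calc ∑ p, m p * gammaTrace H dh p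
      = (L ^ 2)⁻¹ * (∑ p, m p * ∑ l, m l * (∑ i, m i * dh l i p)) - (∑ l, m l * dL l) / L
        + ∑ p, m p * ∑ A : Fin 2, ∑ B : Fin 2,
          Q A B * (dh B.succ A.succ p - 1 / 2 * dh p A.succ B.succ) := by
        simp only [e, mul_add, mul_sub, Finset.sum_add_distrib, Finset.sum_sub_distrib,
          Finset.mul_sum, Finset.sum_div]
        congr 1
        congr 1
        · exact Finset.sum_congr rfl fun _ _ => Finset.sum_congr rfl fun _ _ =>
            Finset.sum_congr rfl fun _ _ => by ring
        · exact Finset.sum_congr rfl fun _ _ => by ring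
    _ = _ := by
        rw [e1, e2]
        field_simp
        ring

/-- The tangential part of the divergence of a symmetric tensor. -/
theorem divForm_tangential (hL : L ≠ 0) (hS : IsSplit (L ^ 2)⁻¹ m Q H)
    (hJ : FrameJets L κ m kt K dh dK dL dκ E F dkt) (hF : ∀ l A, F l A = ∑ B, Q A B * E l B)
    (A : Fin 2) :
    divForm H K dh dK A.succ = (L ^ 2)⁻¹ * ∑ l, m l * dkt l A
      + L⁻¹ * (∑ B, ∑ C, Q B C * hatK L m dh E B C) * kt A
      - (L ^ 2)⁻¹ * kt A * ((∑ l, m l * dL l) / L)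
      + divForm Q (fun B C => K B.succ C.succ) (fun B C D => dh B.succ C.succ D.succ)
          (fun B C D => dK B.succ C.succ D.succ) A
      + ∑ B, ∑ C, Q B C * (dL B.succ / L) * K C.succ A.succ
      - κ * (dL A.succ / L) - (L ^ 2)⁻¹ * ∑ B, F A.succ B * kt B := by
  rw [divForm_split hS K dh dK
    hJ.tensor_symm hJ.metric_symm, gammaTrace_normal hL hS hJ]
  simp only [gammaTrace_succ hL hS hJ, hJ.dh_mixed, hJ.dh_normal, hJ.mixed, hJ.normal,
    hJ.dK_mixed]
  unfold divForm
  generalize (∑ B, ∑ C, Q B C * hatK L m dh E B C) = tr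
  generalize gammaTrace Q (fun B C D => dh B.succ C.succ D.succ) = V
  -- With F = QE, the terms m(F)K from `dK_mixed` cancel those from m(E) in `gammaTrace_succ`; only
  -- tangential derivatives of the shift remain.
  simp only [hF, Fin.sum_univ_three, Fin.sum_univ_two]
  rw [hS.symm 1 0]
  field_simp
  ring

/-- The normal part of the divergence of a symmetric tensor. -/
theorem divForm_normal (hL : L ≠ 0) (hS : IsSplit (L ^ 2)⁻¹ m Q H)
    (hJ : FrameJets L κ m kt K dh dK dL dκ E F dkt) (hF : ∀ l A, F l A = ∑ B, Q A B * E l B) :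
    ∑ j, m j * divForm H K dh dK j = ∑ l, m l * dκ l
      + κ * L * (∑ B, ∑ C, Q B C * hatK L m dh E B C)
      + (∑ A, ∑ B, Q A B * dkt A.succ B
        - ∑ A, ∑ B, Q A B * kt A *
          gammaTrace Q (fun A B C => dh A.succ B.succ C.succ) B)
      + ∑ A, ∑ B, Q A B * kt A * (dL B.succ / L)
      - L * ∑ A, ∑ B, ∑ C, ∑ D, Q A C * Q B D * K A.succ B.succ * hatK L m dh E C D := by
  have s0 : (Fin.succ (0 : Fin 2)) = 1 := rfl
  have s1 : (Fin.succ (1 : Fin 2)) = 2 := rfl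
  have t1 : ∑ j, m j * ((L ^ 2)⁻¹ * ∑ l, m l * (∑ i, m i * dK l i j))
      = (L ^ 2)⁻¹ * ∑ l, m l * ∑ i, m i * ∑ j, m j * dK l i j := by
    simp only [Fin.sum_univ_three]
    ring
  have t2 : ∑ j, m j * ∑ A, ∑ B, Q A B * dK B.succ A.succ j
      = ∑ A, ∑ B, Q A B * ∑ i, m i * dK B.succ i A.succ := by
    have e : ∀ l (A : Fin 2), ∑ i, m i * dK l i A.succ = ∑ j, m j * dK l A.succ j := fun l A =>
      Finset.sum_congr rfl fun i _ => by rw [hJ.deriv_symm]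
    simp only [e, Fin.sum_univ_three, Fin.sum_univ_two]
    ring
  have t3 : ∑ j, m j * ((L ^ 2)⁻¹ * (∑ i, m i * K i j) * (∑ p, m p * gammaTrace H dh p))
      = (L ^ 2)⁻¹ * (∑ i, m i * ∑ j, m j * K i j) * (∑ p, m p * gammaTrace H dh p) := by
    generalize (∑ p, m p * gammaTrace H dh p) = V
    simp only [Fin.sum_univ_three]
    ring
  have t4 : ∑ j, m j * ∑ A, ∑ B, Q A B * K B.succ j * gammaTrace H dh A.succ
      = ∑ A, ∑ B, Q A B * (∑ i, m i * K i B.succ) * gammaTrace H dh A.succ := by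
    have e : ∀ A : Fin 2, ∑ i, m i * K i A.succ = ∑ j, m j * K A.succ j := fun A =>
      Finset.sum_congr rfl fun i _ => by rw [hJ.tensor_symm]
    simp only [e, Fin.sum_univ_three, Fin.sum_univ_two]
    ring
  -- Derivatives of the surface metric along m are traded for `hatK`.
  have t5 : ∀ A B : Fin 2, ∑ l, m l * dh l A.succ B.succ
      = 2 * L * hatK L m dh E A B + E A.succ B + E B.succ A := by
    intro A B
    unfold hatK
    field_simp
    ring
  have key : ∑ j, m j * divForm H K dh dK j =
      ∑ j, m j * ((L ^ 2)⁻¹ * ∑ l, m l * (∑ i, m i * dK l i j))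
      + ∑ j, m j * ∑ A, ∑ B, Q A B * dK B.succ A.succ j
      - ∑ j, m j * ((L ^ 2)⁻¹ * (∑ i, m i * K i j) * (∑ p, m p * gammaTrace H dh p))
      - ∑ j, m j * ∑ A, ∑ B, Q A B * K B.succ j * gammaTrace H dh A.succ
      - 1 / 2 * (((L ^ 2)⁻¹) ^ 2 * (L ^ 2 * κ) * (2 * L * ∑ l, m l * dL l)
        + 2 * (L ^ 2)⁻¹ * ∑ A, ∑ B, Q A B * kt A * (∑ l, m l * E l B)
        + ∑ A, ∑ B, (∑ C, ∑ D, Q A C * K C.succ D.succ * Q D B)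
          * (∑ l, m l * dh l A.succ B.succ)) := by
    simp only [divForm_split hS K dh dK hJ.tensor_symm hJ.metric_symm, hJ.dh_normal,
      hJ.dh_mixed, hJ.normal, hJ.mixed, mul_sub, mul_add, Finset.sum_sub_distrib,
      Finset.sum_add_distrib]
    congr 1
    simp only [Fin.sum_univ_three, Fin.sum_univ_two]
    ring
  rw [key, t1, t2, t3, t4, gammaTrace_normal hL hS hJ]
  simp only [gammaTrace_succ hL hS hJ, hJ.mixed, hJ.normal, hJ.dK_mixed, hJ.dK_normal, t5]
  generalize gammaTrace Q (fun B C D => dh B.succ C.succ D.succ) = V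
  generalize hatK L m dh E = k
  -- The terms κ m(L)/L occur with weights 2, -1, -1 and cancel, as do the contractions of `kt` with
  -- the derivatives of the shift along m.
  simp only [hF, Fin.sum_univ_three, Fin.sum_univ_two, s0, s1]
  rw [hS.symm 1 0, hJ.tensor_symm 2 1]
  field_simp
  ring

end Frame
end Algebra
end FoliatedSpacetime

namespace FoliatedSpacetime

/-! ### The metric components in adapted coordinates -/

section Pointwise

variable (g G : Pt → Matrix (Fin 4) (Fin 4) ℝ) (Ω : Pt → ℝ) (x : Pt)

theorem normalCo_succ (i : Fin 3) : normalCo g x i.succ = 0 := by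
  simp [normalCo]

theorem normalCo_zero : normalCo g x 0 = -lapse g x := by
  simp [normalCo]

theorem normal_eq (a : Fin 4) : normal g x a = -((g x)⁻¹ a 0 * lapse g x) := by
  simp [normal, Fin.sum_univ_succ, normalCo_succ, normalCo_zero]

theorem h3_eq : h3 g x = onSigma g x := by
  ext i j
  simp [h3, onSigma, h, normalCo_succ]

theorem nHatCo_zero : nHatCo g x 0 = 0 := by simp [nHatCo]

theorem nHatCo_one : nHatCo g x 1 = lapseHat g x := by simp [nHatCo]

theorem nHatCo_idxS (A : Fin 2) : nHatCo g x A.succ.succ = 0 := by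
  have : A.succ.succ ≠ (1 : Fin 4) := fun h => Fin.succ_ne_zero A (Fin.succ_injective 3 h)
  simp [nHatCo, this]

theorem gammaHatS_apply (A B : Fin 2) : gammaHatS g x A B = h3 g x A.succ B.succ := by
  simp [gammaHatS, onS, idxS, gammaHat, nHatCo_idxS, onSigma]

theorem shiftHat_eq (a : Fin 4) : shiftHat g x a = gammaHatMix g x a 1 := by
  simp [shiftHat, Pi.single_apply]

end Pointwise

namespace IsAdapted

variable {g G : Pt → Matrix (Fin 4) (Fin 4) ℝ} {Ω : Pt → ℝ} {U : Set Pt} {x : Pt}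

/-- The inverse of a singular matrix is 0 by convention, which contradicts g^{00} < 0. -/
theorem isUnit_det (hA : IsAdapted g G Ω U) (hx : x ∈ U) : IsUnit (g x).det := by
  by_contra hc
  have := hA.timelike x hx
  rw [Matrix.nonsing_inv_apply_not_isUnit _ hc] at this
  simp at this

theorem lapse_pos (hA : IsAdapted g G Ω U) (hx : x ∈ U) : 0 < lapse g x := by
  have := hA.timelike x hx
  exact inv_pos.2 (Real.sqrt_pos.2 (by linarith))

theorem inv_zero_zero (hA : IsAdapted g G Ω U) (hx : x ∈ U) :
    (g x)⁻¹ 0 0 = -((lapse g x) ^ 2)⁻¹ := by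
  have := hA.timelike x hx
  rw [lapse, inv_pow, Real.sq_sqrt (by linarith), inv_inv, neg_neg]

theorem inv_symm (hA : IsAdapted g G Ω U) (hx : x ∈ U) (a b : Fin 4) :
    (g x)⁻¹ a b = (g x)⁻¹ b a := by
  have : ((g x)⁻¹).IsSymm := by
    unfold Matrix.IsSymm
    rw [Matrix.transpose_nonsing_inv, hA.symm_metric x hx]
  exact (this.apply a b).symm

/-- For a spatial index, the shift is n^i n_0 = N² g^{i0}, and N ≠ 0. -/
theorem inv_succ_zero (hA : IsAdapted g G Ω U) (hx : x ∈ U) (i : Fin 3) :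
    (g x)⁻¹ i.succ 0 = 0 := by
  have h1 := hA.shift_eq_zero x hx i.succ
  have hN := (hA.lapse_pos hx).ne'
  simp only [shift, hMix, normal_eq, Fin.sum_univ_succ, normalCo_zero] at h1
  simpa [hN] using h1

theorem inv_zero_succ (hA : IsAdapted g G Ω U) (hx : x ∈ U) (i : Fin 3) :
    (g x)⁻¹ 0 i.succ = 0 := by
  rw [hA.inv_symm hx, hA.inv_succ_zero hx]

theorem metric_succ_zero (hA : IsAdapted g G Ω U) (hx : x ∈ U) (i : Fin 3) :
    g x i.succ 0 = 0 := by
  have h1 : (g x * (g x)⁻¹) i.succ 0 = 0 := by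
    rw [Matrix.mul_nonsing_inv _ (hA.isUnit_det hx)]
    simp
  rw [Matrix.mul_apply, Fin.sum_univ_succ] at h1
  simp only [hA.inv_succ_zero hx, mul_zero, Finset.sum_const_zero, add_zero] at h1
  exact (mul_eq_zero.1 h1).resolve_right (hA.timelike x hx).ne

theorem metric_zero_succ (hA : IsAdapted g G Ω U) (hx : x ∈ U) (i : Fin 3) :
    g x 0 i.succ = 0 := by
  rw [← hA.metric_succ_zero hx i]
  exact (hA.symm_metric x hx).apply _ _

theorem metric_zero_zero (hA : IsAdapted g G Ω U) (hx : x ∈ U) :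
    g x 0 0 = -(lapse g x) ^ 2 := by
  have h1 : (g x * (g x)⁻¹) 0 0 = 1 := by
    rw [Matrix.mul_nonsing_inv _ (hA.isUnit_det hx)]
    simp
  rw [Matrix.mul_apply, Fin.sum_univ_succ] at h1
  simp only [hA.inv_succ_zero hx, mul_zero, Finset.sum_const_zero, add_zero,
    hA.inv_zero_zero hx] at h1
  have hN := (hA.lapse_pos hx).ne'
  field_simp at h1
  linarith

theorem normal_zero (hA : IsAdapted g G Ω U) (hx : x ∈ U) : normal g x 0 = (lapse g x)⁻¹ := by
  have hN := (hA.lapse_pos hx).ne'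
  rw [normal_eq, hA.inv_zero_zero hx]
  field_simp

theorem normal_succ (hA : IsAdapted g G Ω U) (hx : x ∈ U) (i : Fin 3) :
    normal g x i.succ = 0 := by
  rw [normal_eq, hA.inv_succ_zero hx]; simp

theorem h_zero_left (hA : IsAdapted g G Ω U) (hx : x ∈ U) (a : Fin 4) : h g x 0 a = 0 := by
  refine Fin.cases ?_ (fun i => ?_) a
  · simp [h, hA.metric_zero_zero hx, normalCo_zero]; ring
  · simp [h, hA.metric_zero_succ hx, normalCo_succ]

theorem h_symm (hA : IsAdapted g G Ω U) (hx : x ∈ U) (a b : Fin 4) : h g x a b = h g x b a := by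
  simp [h, (hA.symm_metric x hx).apply a b, mul_comm]

theorem h_zero_right (hA : IsAdapted g G Ω U) (hx : x ∈ U) (a : Fin 4) : h g x a 0 = 0 := by
  rw [hA.h_symm hx, hA.h_zero_left hx]

theorem h3_symm (hA : IsAdapted g G Ω U) (hx : x ∈ U) (i j : Fin 3) :
    h3 g x i j = h3 g x j i := hA.h_symm hx _ _

theorem hMix_zero_left (hA : IsAdapted g G Ω U) (hx : x ∈ U) (a : Fin 4) :
    hMix g x 0 a = 0 := by
  have hN := (hA.lapse_pos hx).ne'
  refine Fin.cases ?_ (fun i => ?_) a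
  · simp [hMix, hA.normal_zero hx, normalCo_zero, hN]
  · simp [hMix, normalCo_succ, (Fin.succ_ne_zero i).symm]

theorem hMix_succ_left (hA : IsAdapted g G Ω U) (hx : x ∈ U) (i : Fin 3) (a : Fin 4) :
    hMix g x i.succ a = (1 : Matrix (Fin 4) (Fin 4) ℝ) i.succ a := by
  simp [hMix, hA.normal_succ hx]

theorem h3_posDef (hA : IsAdapted g G Ω U) (hx : x ∈ U) : (h3 g x).PosDef := by
  rw [h3_eq]; exact hA.spacelike x hx

/-- As g is block diagonal, inverting commutes with restriction to the spatial block. -/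
theorem h3_inv_apply (hA : IsAdapted g G Ω U) (hx : x ∈ U) (i j : Fin 3) :
    (h3 g x)⁻¹ i j = (g x)⁻¹ i.succ j.succ := by
  have : (h3 g x)⁻¹ = onSigma (fun y => (g y)⁻¹) x := by
    refine Matrix.inv_eq_right_inv ?_
    ext i j
    have h1 := congrFun (congrFun (Matrix.mul_nonsing_inv _ (hA.isUnit_det hx)) i.succ) j.succ
    rw [Matrix.mul_apply, Fin.sum_univ_succ, hA.metric_succ_zero hx, zero_mul, zero_add] at h1
    rw [h3_eq, Matrix.mul_apply]
    simpa [onSigma, Matrix.one_apply] using h1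
  rw [this]; rfl

theorem hUp_zero_left (hA : IsAdapted g G Ω U) (hx : x ∈ U) (a : Fin 4) : hUp g x 0 a = 0 := by
  have hN := (hA.lapse_pos hx).ne'
  refine Fin.cases ?_ (fun i => ?_) a
  · simp [hUp, hA.normal_zero hx, hA.inv_zero_zero hx]; ring
  · simp [hUp, hA.normal_succ hx, hA.inv_zero_succ hx]

theorem hUp_succ (hA : IsAdapted g G Ω U) (hx : x ∈ U) (i j : Fin 3) :
    hUp g x i.succ j.succ = (h3 g x)⁻¹ i j := by
  rw [hA.h3_inv_apply hx]; simp [hUp, hA.normal_succ hx]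

theorem h3_inv_symm (hA : IsAdapted g G Ω U) (hx : x ∈ U) (i j : Fin 3) :
    (h3 g x)⁻¹ i j = (h3 g x)⁻¹ j i := by
  rw [hA.h3_inv_apply hx, hA.h3_inv_apply hx, hA.inv_symm hx]

theorem h3_inv_pos (hA : IsAdapted g G Ω U) (hx : x ∈ U) : 0 < (h3 g x)⁻¹ 0 0 :=
  (hA.h3_posDef hx).inv.diag_pos

theorem h3_inv_zero_zero (hA : IsAdapted g G Ω U) (hx : x ∈ U) :
    (h3 g x)⁻¹ 0 0 = ((lapseHat g x) ^ 2)⁻¹ := by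
  have h1 : hUp g x 1 1 = (h3 g x)⁻¹ 0 0 := hA.hUp_succ hx 0 0
  rw [lapseHat, h1, inv_pow, Real.sq_sqrt (hA.h3_inv_pos hx).le, inv_inv]

theorem lapseHat_pos (hA : IsAdapted g G Ω U) (hx : x ∈ U) : 0 < lapseHat g x := by
  have h1 : hUp g x 1 1 = (h3 g x)⁻¹ 0 0 := hA.hUp_succ hx 0 0
  rw [lapseHat, h1]
  exact inv_pos.2 (Real.sqrt_pos.2 (hA.h3_inv_pos hx))

theorem nHat_zero (hA : IsAdapted g G Ω U) (hx : x ∈ U) : nHat g x 0 = 0 := by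
  simp [nHat, hA.hUp_zero_left hx]

theorem nHat_succ (hA : IsAdapted g G Ω U) (hx : x ∈ U) (i : Fin 3) :
    nHat g x i.succ = (h3 g x)⁻¹ i 0 * lapseHat g x := by
  rw [nHat, Fin.sum_univ_succ, Fin.sum_univ_succ]
  simp [nHatCo_zero, nHatCo_one, nHatCo_idxS, ← hA.hUp_succ hx]

theorem nHat_one (hA : IsAdapted g G Ω U) (hx : x ∈ U) : nHat g x 1 = (lapseHat g x)⁻¹ := by
  have := hA.nHat_succ hx 0
  rw [hA.h3_inv_zero_zero hx] at this
  have hL := (hA.lapseHat_pos hx).ne'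
  rw [show (1 : Fin 4) = Fin.succ 0 from rfl, this]
  field_simp

theorem gammaHatMix_zero_left (hA : IsAdapted g G Ω U) (hx : x ∈ U) (a : Fin 4) :
    gammaHatMix g x 0 a = 0 := by
  simp [gammaHatMix, hA.hMix_zero_left hx, hA.nHat_zero hx]

theorem gammaHatMix_idxS_right (hA : IsAdapted g G Ω U) (hx : x ∈ U) (i : Fin 3) (A : Fin 2) :
    gammaHatMix g x i.succ A.succ.succ = (1 : Matrix (Fin 3) (Fin 3) ℝ) i A.succ := by
  simp [gammaHatMix, hA.hMix_succ_left hx, nHatCo_idxS, Matrix.one_apply]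

theorem shiftHat_one (hA : IsAdapted g G Ω U) (hx : x ∈ U) : shiftHat g x 1 = 0 := by
  have hL := (hA.lapseHat_pos hx).ne'
  have := hA.hMix_succ_left hx 0 1
  rw [shiftHat_eq, gammaHatMix, hA.nHat_one hx, nHatCo_one]
  rw [show (1 : Fin 4) = Fin.succ 0 from rfl] at this ⊢
  rw [this]
  simp [hL]

theorem h3_inv_succ_zero (hA : IsAdapted g G Ω U) (hx : x ∈ U) (A : Fin 2) :
    (h3 g x)⁻¹ A.succ 0 = -(((lapseHat g x) ^ 2)⁻¹ * onS₁ (shiftHat g) x A) := by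
  have hL := (hA.lapseHat_pos hx).ne'
  have h1 := hA.hMix_succ_left hx A.succ 1
  have h2 : A.succ.succ ≠ (1 : Fin 4) := fun h => Fin.succ_ne_zero A (Fin.succ_injective 3 h)
  simp only [onS₁, idxS]
  rw [shiftHat_eq, gammaHatMix, h1, nHatCo_one, hA.nHat_succ hx, Matrix.one_apply_ne h2]
  field_simp
  ring

theorem nHat_idxS (hA : IsAdapted g G Ω U) (hx : x ∈ U) (A : Fin 2) :
    nHat g x A.succ.succ = -(onS₁ (shiftHat g) x A * (lapseHat g x)⁻¹) := by
  have hL := (hA.lapseHat_pos hx).ne'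
  rw [hA.nHat_succ hx, hA.h3_inv_succ_zero hx]
  field_simp

theorem h3_mul_inv (hA : IsAdapted g G Ω U) (hx : x ∈ U) (i j : Fin 3) :
    ∑ k, h3 g x i k * (h3 g x)⁻¹ k j = (1 : Matrix (Fin 3) (Fin 3) ℝ) i j := by
  rw [← Matrix.mul_nonsing_inv (h3 g x) ((Matrix.isUnit_iff_isUnit_det _).1
    (hA.h3_posDef hx).isUnit), Matrix.mul_apply]

/-- The covector `N̂_A`. -/
theorem h3_succ_zero (hA : IsAdapted g G Ω U) (hx : x ∈ U) (A : Fin 2) :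
    h3 g x A.succ 0 = ∑ B, gammaHatS g x A B * onS₁ (shiftHat g) x B := by
  have hL := (hA.lapseHat_pos hx).ne'
  have h1 := hA.h3_mul_inv hx A.succ 0
  rw [Fin.sum_univ_succ, hA.h3_inv_zero_zero hx, Matrix.one_apply_ne (Fin.succ_ne_zero A)] at h1
  simp only [hA.h3_inv_succ_zero hx, gammaHatS_apply, Fin.sum_univ_two] at h1 ⊢
  field_simp at h1
  linarith

theorem h3_zero_succ (hA : IsAdapted g G Ω U) (hx : x ∈ U) (A : Fin 2) :
    h3 g x 0 A.succ = ∑ B, gammaHatS g x A B * onS₁ (shiftHat g) x B := by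
  rw [hA.h3_symm hx, hA.h3_succ_zero hx]

theorem h3_zero_zero (hA : IsAdapted g G Ω U) (hx : x ∈ U) :
    h3 g x 0 0 = (lapseHat g x) ^ 2 + ∑ A, ∑ B, gammaHatS g x A B
      * onS₁ (shiftHat g) x A * onS₁ (shiftHat g) x B := by
  have hL := (hA.lapseHat_pos hx).ne'
  have h1 := hA.h3_mul_inv hx 0 0
  rw [Fin.sum_univ_succ, hA.h3_inv_zero_zero hx, Matrix.one_apply_eq] at h1
  simp only [hA.h3_inv_succ_zero hx, hA.h3_zero_succ hx, Fin.sum_univ_two] at h1 ⊢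
  field_simp at h1
  linarith

theorem gammaHatS_symm (hA : IsAdapted g G Ω U) (hx : x ∈ U) (A B : Fin 2) :
    gammaHatS g x A B = gammaHatS g x B A := by
  rw [gammaHatS_apply, gammaHatS_apply, hA.h3_symm hx]

theorem gammaHatS_posDef (hA : IsAdapted g G Ω U) (hx : x ∈ U) : (gammaHatS g x).PosDef := by
  have : gammaHatS g x = (h3 g x).submatrix Fin.succ Fin.succ := by
    ext A B; rw [gammaHatS_apply]; rfl
  rw [this]
  exact (hA.h3_posDef hx).submatrix (Fin.succ_injective 2)

/-- Schur complement formula: the inverse of a diagonal block of h is the corresponding block of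
h⁻¹, corrected by the product of its off-diagonal entries divided by h^{ρρ}. -/
theorem gammaHatS_inv_apply (hA : IsAdapted g G Ω U) (hx : x ∈ U) (A B : Fin 2) :
    (gammaHatS g x)⁻¹ A B = (h3 g x)⁻¹ A.succ B.succ
      - ((lapseHat g x) ^ 2)⁻¹ * onS₁ (shiftHat g) x A * onS₁ (shiftHat g) x B := by
  have : (gammaHatS g x)⁻¹ = Matrix.of fun A B : Fin 2 => (h3 g x)⁻¹ A.succ B.succ
      - ((lapseHat g x) ^ 2)⁻¹ * onS₁ (shiftHat g) x A * onS₁ (shiftHat g) x B := by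
    refine Matrix.inv_eq_right_inv ?_
    ext A B
    have h1 := hA.h3_mul_inv hx A.succ B.succ
    rw [Fin.sum_univ_succ, hA.h3_succ_zero hx, hA.h3_inv_symm hx 0, hA.h3_inv_succ_zero hx] at h1
    rw [Matrix.mul_apply]
    simp only [Matrix.one_apply, (Fin.succ_injective 2).eq_iff] at h1 ⊢
    rw [← h1]
    simp only [Fin.sum_univ_two, gammaHatS_apply, Matrix.of_apply]
    ring
  rw [this]; rfl

theorem gammaHatS_inv_symm (hA : IsAdapted g G Ω U) (hx : x ∈ U) (A B : Fin 2) :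
    (gammaHatS g x)⁻¹ A B = (gammaHatS g x)⁻¹ B A := by
  rw [hA.gammaHatS_inv_apply hx, hA.gammaHatS_inv_apply hx, hA.h3_inv_symm hx]
  ring

theorem gammaHatS_inv_mul (hA : IsAdapted g G Ω U) (hx : x ∈ U) (A B : Fin 2) :
    ∑ C, (gammaHatS g x)⁻¹ A C * gammaHatS g x C B = (1 : Matrix (Fin 2) (Fin 2) ℝ) A B := by
  rw [← Matrix.nonsing_inv_mul (gammaHatS g x) ((Matrix.isUnit_iff_isUnit_det _).1
    (hA.gammaHatS_posDef hx).isUnit), Matrix.mul_apply]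

end IsAdapted
end FoliatedSpacetime

namespace FoliatedSpacetime

/-! ### Smoothness and first derivatives of the geometric fields -/

/-- The vector field `∂_ρ - N̂^A ∂_A` on `Σ_τ`. -/
noncomputable def mVec (g : Pt → Matrix (Fin 4) (Fin 4) ℝ) (x : Pt) : Fin 3 → ℝ :=
  Fin.cons 1 fun A => -onS₁ (shiftHat g) x A

theorem mVec_zero (g : Pt → Matrix (Fin 4) (Fin 4) ℝ) (x : Pt) : mVec g x 0 = 1 := rfl

theorem mVec_succ (g : Pt → Matrix (Fin 4) (Fin 4) ℝ) (x : Pt) (A : Fin 2) :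
    mVec g x A.succ = -onS₁ (shiftHat g) x A := rfl

theorem sum_mVec (g : Pt → Matrix (Fin 4) (Fin 4) ℝ) (x : Pt) (f : Fin 3 → ℝ) :
    ∑ i, mVec g x i * f i = f 0 - ∑ A : Fin 2, onS₁ (shiftHat g) x A * f A.succ := by
  rw [Fin.sum_univ_succ, mVec_zero]
  simp only [mVec_succ, neg_mul, Finset.sum_neg_distrib]
  ring

theorem sum_mul_const_mul {ι : Type} [Fintype ι] (c : ℝ) (m f : ι → ℝ) :
    ∑ i, m i * (c * f i) = c * ∑ i, m i * f i := by
  rw [Finset.mul_sum]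
  exact Finset.sum_congr rfl fun _ _ => by ring

/-- The extrinsic curvature of `Σ_τ` as a tensor on `Σ_τ`. -/
noncomputable abbrev K3 (g : Pt → Matrix (Fin 4) (Fin 4) ℝ) : Pt → Matrix (Fin 3) (Fin 3) ℝ :=
  onSigma (K g)

/-- The contraction `K(∂_ρ - N̂^B ∂_B, ∂_A)`. -/
noncomputable def kT (g : Pt → Matrix (Fin 4) (Fin 4) ℝ) (x : Pt) (A : Fin 2) : ℝ :=
  ∑ i, mVec g x i * K3 g x i A.succ

namespace IsAdapted

variable {g G : Pt → Matrix (Fin 4) (Fin 4) ℝ} {Ω : Pt → ℝ} {U : Set Pt} {x : Pt}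

theorem diff (hA : IsAdapted g G Ω U) (hx : x ∈ U) {f : Pt → ℝ} (hf : ContDiffOn ℝ ∞ f U) :
    DifferentiableAt ℝ f x := differentiableAt_of_smooth hA.isOpen hx hf

theorem smooth_inv (hA : IsAdapted g G Ω U) (a b : Fin 4) :
    ContDiffOn ℝ ∞ (fun y => (g y)⁻¹ a b) U :=
  smooth_matrix_inv hA.smooth_metric (fun _ hy => (hA.isUnit_det hy).ne_zero) a b

theorem smooth_lapse (hA : IsAdapted g G Ω U) : ContDiffOn ℝ ∞ (lapse g) U := by
  refine ContDiffOn.inv (ContDiffOn.sqrt (hA.smooth_inv 0 0).neg fun y hy => ?_) fun y hy => ?_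
  · have := hA.timelike y hy; linarith
  · have := hA.timelike y hy
    exact (Real.sqrt_pos.2 (by linarith)).ne'

theorem smooth_lapse_inv (hA : IsAdapted g G Ω U) : ContDiffOn ℝ ∞ (fun y => (lapse g y)⁻¹) U :=
  hA.smooth_lapse.inv fun _ hy => (hA.lapse_pos hy).ne'

theorem smooth_h3 (hA : IsAdapted g G Ω U) (i j : Fin 3) :
    ContDiffOn ℝ ∞ (fun y => h3 g y i j) U := by
  simp only [h3_eq]
  exact hA.smooth_metric _ _

theorem smooth_h3_inv (hA : IsAdapted g G Ω U) (i j : Fin 3) :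
    ContDiffOn ℝ ∞ (fun y => (h3 g y)⁻¹ i j) U :=
  (hA.smooth_inv i.succ j.succ).congr fun _ hy => hA.h3_inv_apply hy i j

theorem smooth_lapseHat (hA : IsAdapted g G Ω U) : ContDiffOn ℝ ∞ (lapseHat g) U := by
  have h1 : ContDiffOn ℝ ∞ (fun y => (Real.sqrt ((h3 g y)⁻¹ 0 0))⁻¹) U :=
    ContDiffOn.inv (ContDiffOn.sqrt (hA.smooth_h3_inv 0 0) fun y hy => (hA.h3_inv_pos hy).ne')
      fun y hy => (Real.sqrt_pos.2 (hA.h3_inv_pos hy)).ne'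
  exact h1.congr fun y hy => by rw [← hA.hUp_succ hy]; rfl

theorem smooth_lapseHat_inv (hA : IsAdapted g G Ω U) :
    ContDiffOn ℝ ∞ (fun y => (lapseHat g y)⁻¹) U :=
  hA.smooth_lapseHat.inv fun _ hy => (hA.lapseHat_pos hy).ne'

theorem smooth_shiftHat (hA : IsAdapted g G Ω U) (A : Fin 2) :
    ContDiffOn ℝ ∞ (fun y => onS₁ (shiftHat g) y A) U := by
  have h1 : ContDiffOn ℝ ∞ (fun y => -((lapseHat g y) ^ 2 * (h3 g y)⁻¹ A.succ 0)) U :=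
    ((hA.smooth_lapseHat.pow 2).mul (hA.smooth_h3_inv _ _)).neg
  refine h1.congr fun y hy => ?_
  have hL := (hA.lapseHat_pos hy).ne'
  rw [hA.h3_inv_succ_zero hy]
  field_simp

theorem smooth_gammaHatS (hA : IsAdapted g G Ω U) (A B : Fin 2) :
    ContDiffOn ℝ ∞ (fun y => gammaHatS g y A B) U := by
  simp only [gammaHatS_apply]
  exact hA.smooth_h3 _ _

theorem smooth_mVec (hA : IsAdapted g G Ω U) (i : Fin 3) :
    ContDiffOn ℝ ∞ (fun y => mVec g y i) U := by
  refine Fin.cases ?_ (fun A => ?_) i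
  · exact contDiffOn_const
  · exact (hA.smooth_shiftHat A).neg

theorem pd_normal_succ (hA : IsAdapted g G Ω U) (hx : x ∈ U) (i : Fin 3) (a : Fin 4) :
    pd a (fun y => normal g y i.succ) x = 0 :=
  pd_eq_zero hA.isOpen hx (fun _ hy => hA.normal_succ hy i) a

theorem lieFun_normal (hA : IsAdapted g G Ω U) (hx : x ∈ U) (f : Pt → ℝ) :
    lieFun id (normal g) f x = (lapse g x)⁻¹ * pd 0 f x := by
  rw [lieFun, Fin.sum_univ_succ]
  simp [hA.normal_zero hx, hA.normal_succ hx]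

/-- The Lie derivative along `n` of a tensor field that annihilates `∂_τ`. -/
theorem lieTensor_normal (hA : IsAdapted g G Ω U) (hx : x ∈ U)
    {T : Pt → Matrix (Fin 4) (Fin 4) ℝ} (h1 : ∀ i : Fin 3, T x 0 i.succ = 0)
    (h2 : ∀ i : Fin 3, T x i.succ 0 = 0) (i j : Fin 3) :
    lieTensor id (normal g) T x i.succ j.succ
      = (lapse g x)⁻¹ * pd 0 (fun y => T y i.succ j.succ) x := by
  rw [lieTensor, Matrix.of_apply, Fin.sum_univ_succ]
  simp [hA.normal_zero hx, hA.normal_succ hx, hA.pd_normal_succ hx, h1, h2]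

theorem K3_eq (hA : IsAdapted g G Ω U) (hx : x ∈ U) (i j : Fin 3) :
    K3 g x i j = 1 / 2 * (lapse g x)⁻¹ * pd 0 (fun y => h3 g y i j) x := by
  have := hA.lieTensor_normal hx (T := h g) (fun i => hA.h_zero_left hx _)
    (fun i => hA.h_zero_right hx _) i j
  simp only [K3, onSigma, K, Matrix.submatrix_apply, Matrix.smul_apply, smul_eq_mul, this,
    mul_assoc]

theorem K3_symm (hA : IsAdapted g G Ω U) (hx : x ∈ U) (i j : Fin 3) :
    K3 g x i j = K3 g x j i := by
  rw [hA.K3_eq hx, hA.K3_eq hx, pd_congr hA.isOpen hx fun y hy => hA.h3_symm hy i j]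

theorem smooth_K3 (hA : IsAdapted g G Ω U) (i j : Fin 3) :
    ContDiffOn ℝ ∞ (fun y => K3 g y i j) U :=
  ((contDiffOn_const.mul hA.smooth_lapse_inv).mul (smooth_pd hA.isOpen (hA.smooth_h3 i j) 0)).congr
    fun _ hy => hA.K3_eq hy i j

theorem smooth_kT (hA : IsAdapted g G Ω U) (A : Fin 2) :
    ContDiffOn ℝ ∞ (fun y => kT g y A) U :=
  ContDiffOn.sum fun i _ => (hA.smooth_mVec i).mul (hA.smooth_K3 i A.succ)

theorem pd_gammaHatS_symm (hA : IsAdapted g G Ω U) (hx : x ∈ U) (A B : Fin 2) (a : Fin 4) :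
    pd a (fun y => gammaHatS g y A B) x = pd a (fun y => gammaHatS g y B A) x :=
  pd_congr hA.isOpen hx (fun _ hy => hA.gammaHatS_symm hy A B) a

theorem pd_h3_succ (g : Pt → Matrix (Fin 4) (Fin 4) ℝ) (x : Pt) (A B : Fin 2) (a : Fin 4) :
    pd a (fun y => h3 g y A.succ B.succ) x = pd a (fun y => gammaHatS g y A B) x := by
  simp only [gammaHatS_apply]

theorem pd_h3_zero_succ (hA : IsAdapted g G Ω U) (hx : x ∈ U) (B : Fin 2) (a : Fin 4) :
    pd a (fun y => h3 g y 0 B.succ) x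
      = ∑ C, (pd a (fun y => gammaHatS g y B C) x * onS₁ (shiftHat g) x C
        + gammaHatS g x B C * pd a (fun y => onS₁ (shiftHat g) y C) x) := by
  rw [pd_congr hA.isOpen hx (fun y hy => hA.h3_zero_succ hy B),
    pd_sum _ fun C _ => (hA.diff hx (hA.smooth_gammaHatS B C)).fun_mul
      (hA.diff hx (hA.smooth_shiftHat C))]
  exact Finset.sum_congr rfl fun C _ => pd_mul (hA.diff hx (hA.smooth_gammaHatS B C))
    (hA.diff hx (hA.smooth_shiftHat C)) a

theorem pd_h3_symm (hA : IsAdapted g G Ω U) (hx : x ∈ U) (i j : Fin 3) (a : Fin 4) :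
    pd a (fun y => h3 g y i j) x = pd a (fun y => h3 g y j i) x :=
  pd_congr hA.isOpen hx (fun _ hy => hA.h3_symm hy i j) a

/-- Leibniz rule for h(m, ∂_B) = 0: the derivative falling on m contributes the derivative of the
shift. With ∂_τ this computes the mixed part of K; with spatial derivatives it feeds the divergence.
-/
theorem sum_mVec_pd_h3 (hA : IsAdapted g G Ω U) (hx : x ∈ U) (B : Fin 2) (a : Fin 4) :
    ∑ i, mVec g x i * pd a (fun y => h3 g y i B.succ) x
      = ∑ C, gammaHatS g x B C * pd a (fun y => onS₁ (shiftHat g) y C) x := by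
  rw [sum_mVec, hA.pd_h3_zero_succ hx]
  simp only [pd_h3_succ, hA.pd_gammaHatS_symm hx _ B, Finset.sum_add_distrib]
  simp only [mul_comm]
  ring

theorem pd_h3_zero_zero (hA : IsAdapted g G Ω U) (hx : x ∈ U) (a : Fin 4) :
    pd a (fun y => h3 g y 0 0) x = 2 * lapseHat g x * pd a (lapseHat g) x
      + ∑ A, (onS₁ (shiftHat g) x A * pd a (fun y => h3 g y 0 A.succ) x
        + h3 g x 0 A.succ * pd a (fun y => onS₁ (shiftHat g) y A) x) := by
  -- One of the two shifts in the quadratic term is absorbed into h_0A, so that the already known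
  -- derivative of h_0A can be reused.
  have e : ∀ y ∈ U, h3 g y 0 0 = lapseHat g y * lapseHat g y
      + ∑ A : Fin 2, onS₁ (shiftHat g) y A * h3 g y 0 A.succ := by
    intro y hy
    simp only [hA.h3_zero_zero hy, hA.h3_zero_succ hy, Fin.sum_univ_two]
    ring
  have d1 := hA.diff hx hA.smooth_lapseHat
  have d2 := fun A => hA.diff hx (hA.smooth_shiftHat A)
  have d3 := fun i j => hA.diff hx (hA.smooth_h3 i j)
  rw [pd_congr hA.isOpen hx e, pd_add (d1.fun_mul d1)
    (DifferentiableAt.fun_sum fun A _ => (d2 A).fun_mul (d3 _ _)), pd_mul d1 d1,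
    pd_sum _ fun A _ => (d2 A).fun_mul (d3 _ _)]
  simp only [pd_mul (d2 _) (d3 _ _), Fin.sum_univ_two]
  ring

theorem sum_mVec_mVec_pd_h3 (hA : IsAdapted g G Ω U) (hx : x ∈ U) (a : Fin 4) :
    ∑ i, mVec g x i * ∑ j, mVec g x j * pd a (fun y => h3 g y i j) x
      = 2 * lapseHat g x * pd a (lapseHat g) x := by
  have e : ∀ i, ∑ j, mVec g x j * pd a (fun y => h3 g y i j) x
      = ∑ j, mVec g x j * pd a (fun y => h3 g y j i) x := fun i =>
    Finset.sum_congr rfl fun j _ => by rw [hA.pd_h3_symm hx]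
  simp only [e]
  rw [sum_mVec]
  simp only [hA.sum_mVec_pd_h3 hx]
  rw [sum_mVec, hA.pd_h3_zero_zero hx]
  simp only [hA.pd_h3_symm hx _ 0, hA.h3_zero_succ hx, Fin.sum_univ_two]
  rw [hA.gammaHatS_symm hx 1 0]
  ring

/-! ### The projections of the extrinsic curvature -/

theorem sum_gammaHatMix (hA : IsAdapted g G Ω U) (hx : x ∈ U) (A : Fin 2) (f : Fin 4 → ℝ) :
    ∑ a, gammaHatMix g x a A.succ.succ * f a = f A.succ.succ := by
  rw [Fin.sum_univ_succ, hA.gammaHatMix_zero_left hx]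
  simp [hA.gammaHatMix_idxS_right hx, Matrix.one_apply]

/-- This is n̂ = N̂⁻¹ m. -/
theorem sum_nHat (hA : IsAdapted g G Ω U) (hx : x ∈ U) (f : Fin 4 → ℝ) :
    ∑ a, nHat g x a * f a = (lapseHat g x)⁻¹ * ∑ i, mVec g x i * f i.succ := by
  rw [Fin.sum_univ_succ, hA.nHat_zero hx, sum_mVec, Fin.sum_univ_succ]
  rw [show nHat g x (Fin.succ 0) = nHat g x 1 from rfl, hA.nHat_one hx]
  simp only [hA.nHat_idxS hx, Fin.sum_univ_two]
  ring

theorem sum_sp_nHat (hA : IsAdapted g G Ω U) (hx : x ∈ U) (f : Fin 3 → ℝ) :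
    ∑ i, sp (nHat g) x i * f i = (lapseHat g x)⁻¹ * ∑ i, mVec g x i * f i := by
  have := hA.sum_nHat hx (Fin.cons 0 f : Fin 4 → ℝ)
  rw [Fin.sum_univ_succ] at this
  simpa [sp] using this

theorem kappa_eq (hA : IsAdapted g G Ω U) (hx : x ∈ U) :
    kappa g x = ((lapseHat g x) ^ 2)⁻¹ * ∑ i, mVec g x i * ∑ j, mVec g x j * K3 g x i j := by
  have e : kappa g x = ∑ a, nHat g x a * ∑ b, nHat g x b * K g x a b := by
    simp only [kappa, Finset.mul_sum, mul_assoc]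
  rw [e]
  simp only [hA.sum_nHat hx]
  simp only [mul_left_comm _ (lapseHat g x)⁻¹, ← Finset.mul_sum]
  rw [← mul_assoc, ← mul_inv, ← sq]
  rfl

theorem kCo_eq (hA : IsAdapted g G Ω U) (hx : x ∈ U) (A : Fin 2) :
    onS₁ (kCo g) x A = (lapseHat g x)⁻¹ * kT g x A := by
  have e : onS₁ (kCo g) x A
      = ∑ a, gammaHatMix g x a A.succ.succ * ∑ b, nHat g x b * K g x a b := by
    simp only [onS₁, idxS, kCo, Finset.mul_sum, mul_assoc]
  rw [e, hA.sum_gammaHatMix hx, hA.sum_nHat hx, kT]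
  congr 1
  exact Finset.sum_congr rfl fun i _ => by rw [hA.K3_symm hx]; rfl

theorem KS_eq (hA : IsAdapted g G Ω U) (hx : x ∈ U) (A B : Fin 2) :
    onS (KS g) x A B = K3 g x A.succ B.succ := by
  have e : onS (KS g) x A B = ∑ a, gammaHatMix g x a A.succ.succ *
      ∑ b, gammaHatMix g x b B.succ.succ * K g x a b := by
    simp only [onS, idxS, Matrix.submatrix_apply, KS, Matrix.of_apply, Finset.mul_sum, mul_assoc]
  rw [e, hA.sum_gammaHatMix hx, hA.sum_gammaHatMix hx]
  rfl

end IsAdapted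
end FoliatedSpacetime

namespace FoliatedSpacetime
namespace IsAdapted

variable {g G : Pt → Matrix (Fin 4) (Fin 4) ℝ} {Ω : Pt → ℝ} {U : Set Pt} {x : Pt}

/-! ### The unknowns of the first order system -/

theorem lieShift_succ (hA : IsAdapted g G Ω U) (hx : x ∈ U) (i : Fin 3) :
    lieShift g x i.succ = (lapse g x)⁻¹ * pd 0 (fun y => shiftHat g y i.succ) x := by
  rw [lieShift, lieVec, Fin.sum_univ_succ]
  simp [hA.normal_zero hx, hA.normal_succ hx, hA.pd_normal_succ hx]

theorem lieShift_one (hA : IsAdapted g G Ω U) (hx : x ∈ U) : sp (lieShift g) x 0 = 0 := by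
  rw [sp, hA.lieShift_succ hx, pd_eq_zero hA.isOpen hx (c := 0), mul_zero]
  exact fun y hy => hA.shiftHat_one hy

theorem onS₁_lieShift (hA : IsAdapted g G Ω U) (hx : x ∈ U) (A : Fin 2) :
    onS₁ (lieShift g) x A = (lapse g x)⁻¹ * pd 0 (fun y => onS₁ (shiftHat g) y A) x :=
  hA.lieShift_succ hx A.succ

theorem smooth_lieShift (hA : IsAdapted g G Ω U) (A : Fin 2) :
    ContDiffOn ℝ ∞ (fun y => onS₁ (lieShift g) y A) U :=
  (hA.smooth_lapse_inv.mul (smooth_pd hA.isOpen (hA.smooth_shiftHat A) 0)).congr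
    fun _ hy => hA.onS₁_lieShift hy A

theorem lieLogOmega_eq (hA : IsAdapted g G Ω U) (hx : x ∈ U) :
    lieLogOmega g Ω x = (lapse g x)⁻¹ * (2 * pd 0 Ω x / Ω x) := by
  have d := hA.diff hx hA.smooth_conf
  have h0 := hA.conf_ne_zero x hx
  have e : (fun y => Real.log (Ω y ^ 2)) = fun y => Real.log (Ω y * Ω y) := by
    funext y; rw [sq]
  rw [lieLogOmega, hA.lieFun_normal hx, e, pd_log (d.fun_mul d) (mul_ne_zero h0 h0), pd_mul d d]
  field_simp
  ring

theorem smooth_lieLogOmega (hA : IsAdapted g G Ω U) : ContDiffOn ℝ ∞ (lieLogOmega g Ω) U :=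
  (hA.smooth_lapse_inv.mul ((contDiffOn_const.mul (smooth_pd hA.isOpen hA.smooth_conf 0)).div
    hA.smooth_conf hA.conf_ne_zero)).congr fun _ hy => hA.lieLogOmega_eq hy

/-- The τ-derivative of h(m, ∂_A) = 0; it makes the mixed part of K an algebraic function of the
unknown L_n N̂^B. -/
theorem kT_eq (hA : IsAdapted g G Ω U) (hx : x ∈ U) (A : Fin 2) :
    kT g x A = 1 / 2 * ∑ B, gammaHatS g x A B * onS₁ (lieShift g) x B := by
  have h1 := hA.sum_mVec_pd_h3 hx A 0
  simp only [kT, hA.K3_eq hx, hA.onS₁_lieShift hx]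
  simp only [sum_mul_const_mul, h1]
  ring

theorem sum_inv_lower (hA : IsAdapted g G Ω U) (hx : x ∈ U) (f : Fin 2 → ℝ) (A : Fin 2) :
    f A = ∑ B, (gammaHatS g x)⁻¹ A B * ∑ C, gammaHatS g x B C * f C := by
  have e : ∑ B, (gammaHatS g x)⁻¹ A B * ∑ C, gammaHatS g x B C * f C
      = ∑ C, (∑ B, (gammaHatS g x)⁻¹ A B * gammaHatS g x B C) * f C := by
    simp only [Fin.sum_univ_two]; ring
  rw [e]
  simp [hA.gammaHatS_inv_mul hx, Matrix.one_apply]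

theorem sum_inv_kT (hA : IsAdapted g G Ω U) (hx : x ∈ U) (A : Fin 2) :
    ∑ B, (gammaHatS g x)⁻¹ A B * kT g x B = 1 / 2 * onS₁ (lieShift g) x A := by
  simp only [hA.kT_eq hx, sum_mul_const_mul, ← hA.sum_inv_lower hx]

/-! ### The conformal metric -/

theorem gammaHat_eq_conf (hA : IsAdapted g G Ω U) (hx : x ∈ U) (A B : Fin 2) :
    gammaHatS g x A B = Ω x ^ 2 * onS (gammaConf g Ω) x A B := by
  have h0 := hA.conf_ne_zero x hx
  simp [onS, gammaConf, h0]

theorem gammaHat_zero_left (hA : IsAdapted g G Ω U) (hx : x ∈ U) (a : Fin 4) :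
    gammaHat g x 0 a = 0 := by
  simp [gammaHat, hA.h_zero_left hx, nHatCo_zero]

theorem gammaHat_zero_right (hA : IsAdapted g G Ω U) (hx : x ∈ U) (a : Fin 4) :
    gammaHat g x a 0 = 0 := by
  simp [gammaHat, hA.h_zero_right hx, nHatCo_zero]

theorem smooth_gammaConf (hA : IsAdapted g G Ω U) (A B : Fin 2) :
    ContDiffOn ℝ ∞ (fun y => onS (gammaConf g Ω) y A B) U := by
  have h1 : ContDiffOn ℝ ∞ (fun y => (Ω y ^ 2)⁻¹ * gammaHatS g y A B) U :=
    ((hA.smooth_conf.pow 2).inv fun y hy => pow_ne_zero 2 (hA.conf_ne_zero y hy)).mul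
      (hA.smooth_gammaHatS A B)
  exact h1.congr fun y hy => by simp [onS, gammaConf]

theorem pd_gammaHatS (hA : IsAdapted g G Ω U) (hx : x ∈ U) (A B : Fin 2) (a : Fin 4) :
    pd a (fun y => gammaHatS g y A B) x = 2 * Ω x * pd a Ω x * onS (gammaConf g Ω) x A B
      + Ω x ^ 2 * pd a (fun y => onS (gammaConf g Ω) y A B) x := by
  have d := hA.diff hx hA.smooth_conf
  have e : ∀ y ∈ U, gammaHatS g y A B = (Ω y * Ω y) * onS (gammaConf g Ω) y A B := fun y hy => by
    rw [hA.gammaHat_eq_conf hy, sq]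
  rw [pd_congr hA.isOpen hx e, pd_mul (d.fun_mul d) (hA.diff hx (hA.smooth_gammaConf A B)),
    pd_mul d d]
  ring

theorem lieConf_eq (hA : IsAdapted g G Ω U) (hx : x ∈ U) (A B : Fin 2) :
    onS (lieTensor id (normal g) (gammaConf g Ω)) x A B
      = (lapse g x)⁻¹ * pd 0 (fun y => onS (gammaConf g Ω) y A B) x :=
  hA.lieTensor_normal hx (fun i => by simp [gammaConf, hA.gammaHat_zero_left hx])
    (fun i => by simp [gammaConf, hA.gammaHat_zero_right hx]) A.succ B.succ

theorem smooth_lieConf (hA : IsAdapted g G Ω U) (A B : Fin 2) :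
    ContDiffOn ℝ ∞ (fun y => onS (lieTensor id (normal g) (gammaConf g Ω)) y A B) U :=
  (hA.smooth_lapse_inv.mul (smooth_pd hA.isOpen (hA.smooth_gammaConf A B) 0)).congr
    fun _ hy => hA.lieConf_eq hy A B

/-- Leibniz rule for ∂_τ(Ω²γ_AB). The second term is the pure trace part, once the first is known to
be trace free. -/
theorem K3_tangential (hA : IsAdapted g G Ω U) (hx : x ∈ U) (A B : Fin 2) :
    K3 g x A.succ B.succ = 1 / 2 * (Ω x ^ 2 * onS (lieTensor id (normal g) (gammaConf g Ω)) x A B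
      + gammaHatS g x A B * lieLogOmega g Ω x) := by
  have h0 := hA.conf_ne_zero x hx
  rw [hA.K3_eq hx, pd_h3_succ, hA.pd_gammaHatS hx, hA.lieConf_eq hx, hA.lieLogOmega_eq hx,
    hA.gammaHat_eq_conf hx]
  field_simp
  ring

/-- The field ∂_τ has constant components, so its Lie derivative is ∂_τ on components. Also γ⁻¹ =
Ω²γ̂⁻¹, and the factor Ω² can be divided out. -/
theorem trace_pd_gammaConf (hA : IsAdapted g G Ω U) (hx : x ∈ U) :
    ∑ A, ∑ B, (gammaHatS g x)⁻¹ A B * pd 0 (fun y => onS (gammaConf g Ω) y A B) x = 0 := by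
  have h0 := hA.conf_ne_zero x hx
  have h1 := hA.trace_free x hx 0 (Or.inl rfl)
  have e1 : ∀ A B, onS (lieTensor id (fun _ => Pi.single 0 1) (gammaConf g Ω)) x A B
      = pd 0 (fun y => onS (gammaConf g Ω) y A B) x := by
    intro A B
    simp only [onS, lieTensor, Matrix.submatrix_apply, Matrix.of_apply, pd_const, mul_zero,
      add_zero, id]
    rw [Finset.sum_eq_single 0]
    · simp
    · intro b _ hb
      simp [hb]
    · simp
  have e2 : (onS (gammaConf g Ω) x)⁻¹ = (Ω x ^ 2) • (gammaHatS g x)⁻¹ := by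
    refine Matrix.inv_eq_left_inv ?_
    ext A B
    rw [← hA.gammaHatS_inv_mul hx, Matrix.mul_apply]
    refine Finset.sum_congr rfl fun C _ => ?_
    rw [hA.gammaHat_eq_conf hx]
    simp only [Matrix.smul_apply, smul_eq_mul]
    ring
  simp only [e1, e2, Matrix.smul_apply, smul_eq_mul, mul_assoc, ← Finset.mul_sum] at h1
  exact (mul_eq_zero.1 h1).resolve_left (pow_ne_zero 2 h0)

theorem trace_inv_mul (hA : IsAdapted g G Ω U) (hx : x ∈ U) :
    ∑ A, ∑ B, (gammaHatS g x)⁻¹ A B * gammaHatS g x A B = 2 := by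
  have h1 := hA.gammaHatS_inv_mul hx 0 0
  have h2 := hA.gammaHatS_inv_mul hx 1 1
  simp only [Fin.sum_univ_two, Matrix.one_apply_eq] at h1 h2 ⊢
  rw [hA.gammaHatS_symm hx 1 0] at h1
  rw [hA.gammaHatS_symm hx 0 1] at h2
  linarith

theorem trace_K3 (hA : IsAdapted g G Ω U) (hx : x ∈ U) :
    ∑ A, ∑ B, (gammaHatS g x)⁻¹ A B * K3 g x A.succ B.succ = lieLogOmega g Ω x := by
  have h1 := hA.trace_pd_gammaConf hx
  have h2 := hA.trace_inv_mul hx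
  simp only [hA.K3_tangential hx, hA.lieConf_eq hx]
  simp only [Fin.sum_univ_two] at h1 h2 ⊢
  linear_combination (1 / 2 * Ω x ^ 2 * (lapse g x)⁻¹) * h1 + 1 / 2 * lieLogOmega g Ω x * h2

/-- All components of γ̂^{ab} with an index τ or ρ vanish, and the others form the inverse of the
surface metric. This links the trace in the definition of `KTF` with the trace on the surface. -/
theorem sum_gammaHatUp (hA : IsAdapted g G Ω U) (hx : x ∈ U) (T : Fin 4 → Fin 4 → ℝ) :
    ∑ a, ∑ b, gammaHatUp g x a b * T a b
      = ∑ A : Fin 2, ∑ B : Fin 2, (gammaHatS g x)⁻¹ A B * T A.succ.succ B.succ.succ := by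
  have hL := (hA.lapseHat_pos hx).ne'
  have n1 : nHat g x (Fin.succ 0) = (lapseHat g x)⁻¹ := hA.nHat_one hx
  have z1 : ∀ a, gammaHatUp g x 0 a = 0 := fun a => by
    simp [gammaHatUp, hA.hUp_zero_left hx, hA.nHat_zero hx]
  have hs : ∀ a b, gammaHatUp g x a b = gammaHatUp g x b a := fun a b => by
    simp only [gammaHatUp, hUp, hA.inv_symm hx a b]; ring
  have z2 : ∀ a, gammaHatUp g x a 0 = 0 := fun a => by rw [hs, z1]
  have o1 : ∀ A : Fin 2, gammaHatUp g x A.succ.succ (Fin.succ 0) = 0 := fun A => by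
    rw [gammaHatUp, hA.hUp_succ hx, hA.h3_inv_succ_zero hx, hA.nHat_idxS hx, n1]
    field_simp
    ring
  have o2 : ∀ A : Fin 2, gammaHatUp g x (Fin.succ 0) A.succ.succ = 0 := fun A => by rw [hs, o1]
  have o3 : gammaHatUp g x (Fin.succ 0) (Fin.succ 0) = 0 := by
    rw [gammaHatUp, hA.hUp_succ hx, hA.h3_inv_zero_zero hx, n1]
    field_simp
    ring
  have q : ∀ A B : Fin 2, gammaHatUp g x A.succ.succ B.succ.succ = (gammaHatS g x)⁻¹ A B :=
    fun A B => by
      rw [gammaHatUp, hA.hUp_succ hx, hA.gammaHatS_inv_apply hx, hA.nHat_idxS hx, hA.nHat_idxS hx]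
      field_simp
  have e : ∀ f : Fin 4 → ℝ, ∑ a, f a = f 0 + (f (Fin.succ 0) + ∑ A : Fin 2, f A.succ.succ) :=
    fun f => by rw [Fin.sum_univ_succ, Fin.sum_univ_succ]
  simp only [e, z1, z2, o1, o2, o3, q, zero_mul, Finset.sum_const_zero, zero_add]

theorem KTF_eq (hA : IsAdapted g G Ω U) (hx : x ∈ U) (A B : Fin 2) :
    onS (KTF g) x A B = K3 g x A.succ B.succ
      - 1 / 2 * (gammaHatS g x A B * lieLogOmega g Ω x) := by
  have h1 := hA.KS_eq hx A B
  have h2 := hA.sum_gammaHatUp hx (K g x)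
  have h3 := hA.trace_K3 hx
  have e : onS (KTF g) x A B = onS (KS g) x A B - 1 / 2 * gammaHatS g x A B *
      ∑ a, ∑ b, gammaHatUp g x a b * K g x a b := by
    simp only [onS, Matrix.submatrix_apply, KTF, KS, Matrix.of_apply, sub_mul,
      Finset.sum_sub_distrib, Finset.mul_sum]
    congr 1
    exact Finset.sum_congr rfl fun _ _ => Finset.sum_congr rfl fun _ _ => by ring
  rw [e, h1, h2, ← h3, mul_assoc]
  rfl

theorem KTF_eq_conf (hA : IsAdapted g G Ω U) (hx : x ∈ U) (A B : Fin 2) :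
    onS (KTF g) x A B
      = 1 / 2 * (Ω x ^ 2 * onS (lieTensor id (normal g) (gammaConf g Ω)) x A B) := by
  rw [hA.KTF_eq hx, hA.K3_tangential hx]
  ring

/-- The τ-derivative of h(m, m) = N̂²: κ is determined by N̂ and L_n N̂ and involves no unknown. -/
theorem kappa_eq_conf (hA : IsAdapted g G Ω U) (hx : x ∈ U) :
    kappa g x = lieFun id (normal g) (lapseHat g) x / lapseHat g x := by
  have hL := (hA.lapseHat_pos hx).ne'
  have h1 := hA.sum_mVec_mVec_pd_h3 hx 0
  rw [hA.kappa_eq hx, hA.lieFun_normal hx]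
  simp only [hA.K3_eq hx, sum_mul_const_mul, h1]
  field_simp

theorem smooth_kappa (hA : IsAdapted g G Ω U) : ContDiffOn ℝ ∞ (kappa g) U := by
  refine ContDiffOn.congr (ContDiffOn.mul (ContDiffOn.inv (hA.smooth_lapseHat.pow 2) fun y hy =>
    pow_ne_zero 2 (hA.lapseHat_pos hy).ne') (ContDiffOn.sum fun i _ => (hA.smooth_mVec i).mul
      (ContDiffOn.sum fun j _ => (hA.smooth_mVec j).mul (hA.smooth_K3 i j))))
    fun y hy => hA.kappa_eq hy

/-! ### The first jets at a point -/

theorem isSplit (hA : IsAdapted g G Ω U) (hx : x ∈ U) :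
    IsSplit ((lapseHat g x) ^ 2)⁻¹ (mVec g x) (fun A B => (gammaHatS g x)⁻¹ A B)
      (fun i j => (h3 g x)⁻¹ i j) where
  m_zero := rfl
  zero_zero := hA.h3_inv_zero_zero hx
  zero_succ A := by rw [hA.h3_inv_symm hx, hA.h3_inv_succ_zero hx, mVec_succ, mul_neg]
  succ_zero A := by rw [hA.h3_inv_succ_zero hx, mVec_succ, mul_neg]
  succ_succ A B := by
    rw [hA.gammaHatS_inv_apply hx, mVec_succ, mVec_succ]
    ring
  symm := hA.gammaHatS_inv_symm hx

theorem trace_K (hA : IsAdapted g G Ω U) (hx : x ∈ U) :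
    ∑ i, ∑ l, (h3 g x)⁻¹ i l * K3 g x i l = kappa g x + lieLogOmega g Ω x := by
  have hS := hA.isSplit hx
  rw [hA.kappa_eq hx, ← hA.trace_K3 hx]
  simp only [Fin.sum_univ_succ (n := 2), hS.zero_zero, hS.zero_succ, hS.succ_zero, hS.succ_succ,
    hS.m_zero, Fin.sum_univ_two]
  ring

theorem pd_kT (hA : IsAdapted g G Ω U) (hx : x ∈ U) (A : Fin 2) (a : Fin 4) :
    pd a (fun y => kT g y A) x = pd a (fun y => K3 g y 0 A.succ) x
      - ∑ B : Fin 2, (pd a (fun y => onS₁ (shiftHat g) y B) x * K3 g x B.succ A.succ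
        + onS₁ (shiftHat g) x B * pd a (fun y => K3 g y B.succ A.succ) x) := by
  have d1 := fun i j => hA.diff hx (hA.smooth_K3 i j)
  have d2 := fun B => hA.diff hx (hA.smooth_shiftHat B)
  simp only [kT, sum_mVec]
  rw [pd_sub (d1 _ _) (DifferentiableAt.fun_sum fun B _ => (d2 B).fun_mul (d1 _ _)),
    pd_sum _ fun B _ => (d2 B).fun_mul (d1 _ _)]
  simp only [pd_mul (d2 _) (d1 _ _)]

theorem pd_normal_part (hA : IsAdapted g G Ω U) (hx : x ∈ U) (a : Fin 4) :
    2 * lapseHat g x * pd a (lapseHat g) x * kappa g x + (lapseHat g x) ^ 2 * pd a (kappa g) x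
      = pd a (fun y => K3 g y 0 0) x
        - ∑ B : Fin 2, (pd a (fun y => onS₁ (shiftHat g) y B) x * K3 g x 0 B.succ
          + onS₁ (shiftHat g) x B * pd a (fun y => K3 g y 0 B.succ) x)
        - ∑ B : Fin 2, (pd a (fun y => onS₁ (shiftHat g) y B) x * kT g x B
          + onS₁ (shiftHat g) x B * pd a (fun y => kT g y B) x) := by
  have d1 := fun i j => hA.diff hx (hA.smooth_K3 i j)
  have d2 := fun B => hA.diff hx (hA.smooth_shiftHat B)
  have d3 := fun B => hA.diff hx (hA.smooth_kT B)
  have dL := hA.diff hx hA.smooth_lapseHat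
  have dk := hA.diff hx hA.smooth_kappa
  -- K(m, m) = N̂²κ is expanded in one slot only and the other contraction is kept as `kT`, whose
  -- derivative is known.
  have e : ∀ y ∈ U, lapseHat g y * lapseHat g y * kappa g y = K3 g y 0 0
      - ∑ B : Fin 2, onS₁ (shiftHat g) y B * K3 g y 0 B.succ
      - ∑ B : Fin 2, onS₁ (shiftHat g) y B * kT g y B := by
    intro y hy
    have hL := (hA.lapseHat_pos hy).ne'
    rw [hA.kappa_eq hy, ← sq, mul_inv_cancel_left₀ (pow_ne_zero 2 hL)]
    simp only [kT, sum_mVec, hA.K3_symm hy _ 0, Fin.sum_univ_two]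
    rw [hA.K3_symm hy (Fin.succ 0) (Fin.succ 1)]
  have h1 := pd_congr hA.isOpen hx e a
  rw [pd_mul (dL.fun_mul dL) dk, pd_mul dL dL,
    pd_sub ((d1 _ _).fun_sub (DifferentiableAt.fun_sum fun B _ => (d2 B).fun_mul (d1 _ _)))
      (DifferentiableAt.fun_sum fun B _ => (d2 B).fun_mul (d3 _)),
    pd_sub (d1 _ _) (DifferentiableAt.fun_sum fun B _ => (d2 B).fun_mul (d1 _ _)),
    pd_sum _ fun B _ => (d2 B).fun_mul (d1 _ _), pd_sum _ fun B _ => (d2 B).fun_mul (d3 _)] at h1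
  simp only [pd_mul (d2 _) (d1 _ _), pd_mul (d2 _) (d3 _)] at h1
  rw [← h1]
  ring

theorem pd_K3_symm (hA : IsAdapted g G Ω U) (hx : x ∈ U) (i j : Fin 3) (a : Fin 4) :
    pd a (fun y => K3 g y i j) x = pd a (fun y => K3 g y j i) x :=
  pd_congr hA.isOpen hx (fun _ hy => hA.K3_symm hy i j) a

/-- Apart from the symmetries and the undifferentiated contractions, every field is a Leibniz rule
for h(m, ∂_B) = 0, h(m, m) = N̂², K(m, ∂_A) = `kT` or K(m, m) = N̂²κ. The shift derivatives appear
because ∂m^A = -∂N̂^A. -/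
theorem frameJets (hA : IsAdapted g G Ω U) (hx : x ∈ U) :
    FrameJets (lapseHat g x) (kappa g x) (mVec g x) (kT g x) (K3 g x)
      (fun l i j => pd l.succ (fun y => h3 g y i j) x)
      (fun l i j => pd l.succ (fun y => K3 g y i j) x)
      (fun l => pd l.succ (lapseHat g) x) (fun l => pd l.succ (kappa g) x)
      (fun l A => ∑ B, gammaHatS g x A B * pd l.succ (fun y => onS₁ (shiftHat g) y B) x)
      (fun l A => pd l.succ (fun y => onS₁ (shiftHat g) y A) x)
      (fun l A => pd l.succ (fun y => kT g y A) x) where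
  metric_symm l i j := hA.pd_h3_symm hx i j _
  tensor_symm := hA.K3_symm hx
  deriv_symm l i j := hA.pd_K3_symm hx i j _
  dh_mixed l B := hA.sum_mVec_pd_h3 hx B _
  dh_normal l := hA.sum_mVec_mVec_pd_h3 hx _
  mixed B := rfl
  normal := by
    have hL := (hA.lapseHat_pos hx).ne'
    rw [hA.kappa_eq hx, mul_inv_cancel_left₀ (pow_ne_zero 2 hL)]
  dK_mixed l A := by
    rw [sum_mVec, hA.pd_kT hx]
    simp only [Finset.sum_add_distrib]
    ring_nf
  dK_normal l := by
    rw [hA.pd_normal_part hx]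
    simp only [sum_mVec, hA.pd_kT hx, hA.pd_K3_symm hx _ 0, Fin.sum_univ_two]
    simp only [kT, sum_mVec, Fin.sum_univ_two]
    rw [hA.K3_symm hx (Fin.succ 0) (Fin.succ 1), hA.pd_K3_symm hx (Fin.succ 0) (Fin.succ 1)]
    ring

end IsAdapted
end FoliatedSpacetime

namespace FoliatedSpacetime

/-! ### Divergences on the surfaces `S_{τ,ρ}` -/

theorem divForm_linear (Q T₁ T₂ : Fin 2 → Fin 2 → ℝ) (dq dT₁ dT₂ : Fin 2 → Fin 2 → Fin 2 → ℝ)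
    (c : ℝ) (j : Fin 2) :
    divForm Q (fun i k => T₁ i k - c * T₂ i k) dq (fun l i k => dT₁ l i k - c * dT₂ l i k) j
      = divForm Q T₁ dq dT₁ j - c * divForm Q T₂ dq dT₂ j := by
  simp only [divForm, Fin.sum_univ_two]
  ring

/-- The divergence of `f q` for the metric `q` is the gradient of `f`. -/
theorem divForm_metric {Q q : Fin 2 → Fin 2 → ℝ} {dq : Fin 2 → Fin 2 → Fin 2 → ℝ}
    (hQ : ∀ A B, Q A B = Q B A)
    (hQq : ∀ A B, ∑ C, Q A C * q C B = (1 : Matrix (Fin 2) (Fin 2) ℝ) A B)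
    (f : ℝ) (df : Fin 2 → ℝ) (j : Fin 2) :
    divForm Q (fun i k => q i k * f) dq (fun l i k => dq l i k * f + q i k * df l) j = df j := by
  have e1 : ∀ p k, ∑ i, Q p i * (q i k * f) = (1 : Matrix (Fin 2) (Fin 2) ℝ) p k * f := by
    intro p k
    rw [← hQq, Finset.sum_mul]
    exact Finset.sum_congr rfl fun _ _ => by ring
  have e2 : ∀ l p, ∑ i, ∑ k, Q l i * (q i k * f) * Q k p = Q l p * f := by
    intro l p
    rw [Finset.sum_comm]
    simp only [← Finset.sum_mul, e1, Matrix.one_apply]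
    simp [mul_comm]
  have e3 : ∑ i, ∑ l, Q i l * (dq l i j * f + q i j * df l)
      = f * (∑ i, ∑ l, Q i l * dq l i j) + df j := by
    have h0 := hQq 0 j
    have h1 := hQq 1 j
    have e : df j = (1 : Matrix (Fin 2) (Fin 2) ℝ) 0 j * df 0
        + (1 : Matrix (Fin 2) (Fin 2) ℝ) 1 j * df 1 := by
      revert j; simp [Fin.forall_fin_two]
    rw [e, ← h0, ← h1]
    simp only [Fin.sum_univ_two]
    rw [hQ 1 0]
    ring
  have e4 : ∑ p, (1 : Matrix (Fin 2) (Fin 2) ℝ) p j * f * gammaTrace Q dq p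
      = f * gammaTrace Q dq j := by
    simp [Matrix.one_apply]
  simp only [divForm, e1, e2, e3, e4]
  simp only [gammaTrace, Fin.sum_univ_two]
  ring

namespace IsAdapted

variable {g G : Pt → Matrix (Fin 4) (Fin 4) ℝ} {Ω : Pt → ℝ} {U : Set Pt} {x : Pt}

/-- The trace free part is the tangential K minus ½γ̂ L_n ln Ω², and by metric compatibility the
divergence of the subtracted term is half the gradient of L_n ln Ω². -/
theorem div_KTF (hA : IsAdapted g G Ω U) (hx : x ∈ U) (A : Fin 2) :
    ∑ B, ∑ C, (gammaHatS g x)⁻¹ B C * covTensor idxS (gammaHatS g) (onS (KTF g)) x B C A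
      = divForm (fun A B => (gammaHatS g x)⁻¹ A B) (fun B C => K3 g x B.succ C.succ)
        (fun B C D => pd B.succ.succ (fun y => h3 g y C.succ D.succ) x)
        (fun B C D => pd B.succ.succ (fun y => K3 g y C.succ D.succ) x) A
        - 1 / 2 * pd (idxS A) (lieLogOmega g Ω) x := by
  have dK := fun i j => hA.diff hx (hA.smooth_K3 i j)
  have dq := fun A B => hA.diff hx (hA.smooth_gammaHatS A B)
  have dω := hA.diff hx hA.smooth_lieLogOmega
  have hT : ∀ a (C D : Fin 2), pd a (fun y => onS (KTF g) y C D) x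
      = pd a (fun y => K3 g y C.succ D.succ) x
        - 1 / 2 * (pd a (fun y => gammaHatS g y C D) x * lieLogOmega g Ω x
          + gammaHatS g x C D * pd a (lieLogOmega g Ω) x) := fun a C D => by
    rw [pd_congr hA.isOpen hx (fun y hy => hA.KTF_eq hy C D),
      pd_sub (dK _ _) (((dq _ _).fun_mul dω).const_mul _),
      pd_const_mul _ ((dq _ _).fun_mul dω), pd_mul (dq _ _) dω]
  have sT : ∀ C D, onS (KTF g) x C D = onS (KTF g) x D C := fun C D => by
    rw [hA.KTF_eq hx, hA.KTF_eq hx, hA.K3_symm hx, hA.gammaHatS_symm hx]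
  have h1 := contract_cov_eq_divForm_two (fun A B => (gammaHatS g x)⁻¹ A B)
    (fun C D => onS (KTF g) x C D) (fun C A B => pd (idxS C) (fun y => gammaHatS g y A B) x)
    (fun B C D => pd (idxS B) (fun y => onS (KTF g) y C D) x)
    (hA.gammaHatS_inv_symm hx) sT (fun l A B => hA.pd_gammaHatS_symm hx A B _) A
  have h2 : ∑ B, ∑ C, (gammaHatS g x)⁻¹ B C * covTensor idxS (gammaHatS g) (onS (KTF g)) x B C A
      = ∑ B, ∑ C, (gammaHatS g x)⁻¹ B C * covTensor idxS (gammaHatS g) (onS (KTF g)) x C B A := by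
    rw [Finset.sum_comm]
    exact Finset.sum_congr rfl fun _ _ => Finset.sum_congr rfl fun _ _ => by
      rw [hA.gammaHatS_inv_symm hx]
  rw [h2]
  refine Eq.trans h1 ?_
  have h3 := divForm_metric (hA.gammaHatS_inv_symm hx)
    (hA.gammaHatS_inv_mul hx) (dq := fun C A B => pd (idxS C) (fun y => gammaHatS g y A B) x)
    (lieLogOmega g Ω x) (fun l => pd (idxS l) (lieLogOmega g Ω) x) A
  have h4 := divForm_linear (fun A B => (gammaHatS g x)⁻¹ A B) (fun B C => K3 g x B.succ C.succ)
    (fun i k => gammaHatS g x i k * lieLogOmega g Ω x)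
    (fun C A B => pd (idxS C) (fun y => gammaHatS g y A B) x)
    (fun B C D => pd (idxS B) (fun y => K3 g y C.succ D.succ) x)
    (fun l i k => pd (idxS l) (fun y => gammaHatS g y i k) x * lieLogOmega g Ω x
          + gammaHatS g x i k * pd (idxS l) (lieLogOmega g Ω) x) (1 / 2) A
  rw [h3] at h4
  simp only [hT, hA.KTF_eq hx, pd_h3_succ]
  exact h4

/-! ### The extrinsic curvature and the acceleration of the surfaces `S_{τ,ρ}` -/

theorem onSigma_gammaHat_succ (g : Pt → Matrix (Fin 4) (Fin 4) ℝ) (x : Pt) (A : Fin 2)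
    (l : Fin 3) : onSigma (gammaHat g) x A.succ l = h3 g x A.succ l := by
  simp [onSigma, gammaHat, nHatCo_idxS]

theorem pd_nHat_zero (hA : IsAdapted g G Ω U) (hx : x ∈ U) (a : Fin 4) :
    pd a (fun y => sp (nHat g) y 0) x = -(pd a (lapseHat g) x / lapseHat g x ^ 2) := by
  rw [pd_congr (f := fun y => sp (nHat g) y 0) hA.isOpen hx fun y hy => hA.nHat_one hy,
    pd_inv (hA.diff hx hA.smooth_lapseHat) (hA.lapseHat_pos hx).ne']

theorem pd_nHat_succ (hA : IsAdapted g G Ω U) (hx : x ∈ U) (A : Fin 2) (a : Fin 4) :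
    pd a (fun y => sp (nHat g) y A.succ) x
      = -(pd a (fun y => onS₁ (shiftHat g) y A) x * (lapseHat g x)⁻¹
        + onS₁ (shiftHat g) x A * -(pd a (lapseHat g) x / lapseHat g x ^ 2)) := by
  rw [pd_congr (f := fun y => sp (nHat g) y A.succ) hA.isOpen hx
      fun y hy => hA.nHat_idxS hy A, pd_neg,
    pd_mul (hA.diff hx (hA.smooth_shiftHat A)) (hA.diff hx hA.smooth_lapseHat_inv),
    pd_inv (hA.diff hx hA.smooth_lapseHat) (hA.lapseHat_pos hx).ne']

/-- Since γ̂ annihilates m, the derivative of the factor N̂⁻¹ in n̂ = N̂⁻¹ m drops out and only ∂m =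
-∂N̂^A ∂_A is seen. -/
theorem sum_gammaHat_pd_nHat (hA : IsAdapted g G Ω U) (hx : x ∈ U) (A : Fin 2) (a : Fin 4) :
    ∑ l, onSigma (gammaHat g) x A.succ l * pd a (fun y => sp (nHat g) y l) x
      = -((lapseHat g x)⁻¹ *
        ∑ B, gammaHatS g x A B * pd a (fun y => onS₁ (shiftHat g) y B) x) := by
  rw [Fin.sum_univ_succ]
  simp only [hA.pd_nHat_zero hx, hA.pd_nHat_succ hx, onSigma_gammaHat_succ, hA.h3_succ_zero hx,
    ← gammaHatS_apply, Fin.sum_univ_two]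
  ring

theorem KHatS_eq (hA : IsAdapted g G Ω U) (hx : x ∈ U) (A B : Fin 2) :
    KHatS g x A B = hatK (lapseHat g x) (mVec g x)
      (fun l i j => pd l.succ (fun y => h3 g y i j) x)
      (fun l A => ∑ B, gammaHatS g x A B * pd l.succ (fun y => onS₁ (shiftHat g) y B) x) A B := by
  have h1 := hA.sum_gammaHat_pd_nHat hx B A.succ.succ
  have h2 := hA.sum_gammaHat_pd_nHat hx A B.succ.succ
  have hn := hA.sum_sp_nHat hx fun l => pd l.succ (fun y => h3 g y A.succ B.succ) x
  have hs : ∀ l, onSigma (gammaHat g) x l B.succ = onSigma (gammaHat g) x B.succ l := fun l => by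
    simp [onSigma, gammaHat, hA.h_symm hx l.succ, mul_comm]
  have e : ∀ y, onSigma (gammaHat g) y A.succ B.succ = h3 g y A.succ B.succ := fun y =>
    onSigma_gammaHat_succ g y A _
  have e0 : KHatS g x A B = 1 / 2 * (∑ l, sp (nHat g) x l *
      pd l.succ (fun y => onSigma (gammaHat g) y A.succ B.succ) x
      + ∑ l, onSigma (gammaHat g) x l B.succ * pd A.succ.succ (fun y => sp (nHat g) y l) x
      + ∑ l, onSigma (gammaHat g) x A.succ l * pd B.succ.succ (fun y => sp (nHat g) y l) x) := by
    simp only [KHatS, KHat, lieTensor, Matrix.smul_apply, Matrix.of_apply, smul_eq_mul,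
      Finset.sum_add_distrib]
  rw [e0]
  simp only [hs, h1, h2, e, hn, hatK]
  ring

/-- As n̂_A = 0, only Γ^ρ_lA contributes, and h^{ρp} = N̂⁻² m^p turns its contraction with n̂^l into
one with m twice. -/
theorem nHatDot_eq (hA : IsAdapted g G Ω U) (hx : x ∈ U) (A : Fin 2) :
    nHatDot g x A.succ = -(pd (idxS A) (lapseHat g) x / lapseHat g x) := by
  have hL := (hA.lapseHat_pos hx).ne'
  have h1 := hA.sum_mVec_mVec_pd_h3 hx (idxS A)
  have hH : ∀ p, (h3 g x)⁻¹ 0 p = (lapseHat g x ^ 2)⁻¹ * mVec g x p := by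
    intro p
    have hS := hA.isSplit hx
    refine Fin.cases ?_ (fun B => hS.zero_succ B) p
    rw [mVec_zero, mul_one]; exact hS.zero_zero
  have hc : ∀ l, covCo Fin.succ (h3 g) (sp (nHatCo g)) x l A.succ
      = -(1 / 2 * (lapseHat g x)⁻¹ * ∑ p, mVec g x p *
        (pd l.succ (fun y => h3 g y A.succ p) x + pd A.succ.succ (fun y => h3 g y l p) x
          - pd p.succ (fun y => h3 g y l A.succ) x)) := by
    intro l
    have z : ∀ (B : Fin 2) y, sp (nHatCo g) y B.succ = 0 := fun B y => nHatCo_idxS g y B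
    have z' : sp (nHatCo g) x 0 = lapseHat g x := nHatCo_one g x
    rw [covCo, Fin.sum_univ_succ]
    simp only [z, z', pd_const, mul_zero, Finset.sum_const_zero, add_zero, christoffel, hH]
    simp only [mul_assoc, ← Finset.mul_sum]
    field_simp
    ring
  have h0 : nHatDot g x A.succ = -((lapseHat g x)⁻¹ * (1 / 2 * (lapseHat g x)⁻¹ *
      ∑ l, mVec g x l * ∑ p, mVec g x p * (pd l.succ (fun y => h3 g y A.succ p) x
        + pd A.succ.succ (fun y => h3 g y l p) x - pd p.succ (fun y => h3 g y l A.succ) x))) := by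
    rw [nHatDot, hA.sum_sp_nHat hx]
    simp only [hc, mul_neg, Finset.sum_neg_distrib, sum_mul_const_mul]
  -- The first and third terms are exchanged by swapping l and p, hence cancel under the symmetric
  -- contraction.
  have h2 : ∑ l, mVec g x l * ∑ p, mVec g x p * (pd l.succ (fun y => h3 g y A.succ p) x
        + pd A.succ.succ (fun y => h3 g y l p) x - pd p.succ (fun y => h3 g y l A.succ) x)
      = ∑ i, mVec g x i * ∑ j, mVec g x j * pd (idxS A) (fun y => h3 g y i j) x := by
    simp only [hA.pd_h3_symm hx A.succ, idxS, Fin.sum_univ_three]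
    ring
  rw [h0, h2, h1]
  field_simp

theorem lieLogLapseHat_eq (hA : IsAdapted g G Ω U) (hx : x ∈ U) :
    lieLogLapseHat g x
      = (lapseHat g x)⁻¹ * ((∑ l, mVec g x l * pd l.succ (lapseHat g) x) / lapseHat g x) := by
  rw [lieLogLapseHat, lieFun, hA.sum_sp_nHat hx, Finset.sum_div]
  simp only [pd_log (hA.diff hx hA.smooth_lapseHat) (hA.lapseHat_pos hx).ne', mul_div_assoc]

/-- L_n N̂ has no ρ-component, so its bracket with n̂ is the derivative along n̂ minus the
tangential derivative of n̂. Lowering the index leaves only derivatives of the shift from the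
latter. -/
theorem lower_lie_nHat_lieShift (hA : IsAdapted g G Ω U) (hx : x ∈ U) (A : Fin 2) :
    ∑ j, onSigma (gammaHat g) x A.succ j * lieVec Fin.succ (sp (nHat g)) (sp (lieShift g)) x j
      = (lapseHat g x)⁻¹ * ((∑ B, gammaHatS g x A B *
          ∑ l, mVec g x l * pd l.succ (fun y => onS₁ (lieShift g) y B) x)
        + ∑ C, onS₁ (lieShift g) x C *
          ∑ B, gammaHatS g x A B * pd (idxS C) (fun y => onS₁ (shiftHat g) y B) x) := by
  have z : ∀ a, pd a (fun y => sp (lieShift g) y 0) x = 0 := fun a =>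
    pd_eq_zero hA.isOpen hx (fun y hy => hA.lieShift_one hy) a
  have e : ∀ j, lieVec Fin.succ (sp (nHat g)) (sp (lieShift g)) x j
      = (lapseHat g x)⁻¹ * ∑ l, mVec g x l * pd l.succ (fun y => sp (lieShift g) y j) x
        - ∑ C : Fin 2, onS₁ (lieShift g) x C * pd (idxS C) (fun y => sp (nHat g) y j) x := by
    intro j
    rw [lieVec, Finset.sum_sub_distrib, hA.sum_sp_nHat hx, Fin.sum_univ_succ (n := 2)
      (f := fun l => sp (lieShift g) x l * _), hA.lieShift_one hx, zero_mul, zero_add]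
    rfl
  have h1 : ∑ j, onSigma (gammaHat g) x A.succ j *
      ∑ l, mVec g x l * pd l.succ (fun y => sp (lieShift g) y j) x
      = ∑ B, gammaHatS g x A B *
          ∑ l, mVec g x l * pd l.succ (fun y => onS₁ (lieShift g) y B) x := by
    rw [Fin.sum_univ_succ]
    simp only [z, mul_zero, Finset.sum_const_zero, zero_add, onSigma_gammaHat_succ,
      gammaHatS_apply]
    rfl
  have h2 : ∑ j, onSigma (gammaHat g) x A.succ j *
      ∑ C : Fin 2, onS₁ (lieShift g) x C * pd (idxS C) (fun y => sp (nHat g) y j) x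
      = ∑ C, onS₁ (lieShift g) x C * -((lapseHat g x)⁻¹ *
          ∑ B, gammaHatS g x A B * pd (idxS C) (fun y => onS₁ (shiftHat g) y B) x) := by
    simp only [← hA.sum_gammaHat_pd_nHat hx]
    simp only [Finset.mul_sum]
    rw [Finset.sum_comm]
    exact Finset.sum_congr rfl fun _ _ => Finset.sum_congr rfl fun _ _ => by ring
  simp only [e, mul_sub, Finset.sum_sub_distrib, h2]
  rw [sum_mul_const_mul, h1]
  simp only [mul_neg, Finset.sum_neg_distrib, sum_mul_const_mul]
  ring

/-! ### The projections of the momentum constraint -/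

theorem momentumConstraint_eq (hA : IsAdapted g G Ω U) (hx : x ∈ U) (j : Fin 3) :
    momentumConstraint g G x j
      = divForm (fun i j => (h3 g x)⁻¹ i j) (K3 g x)
          (fun l i j => pd l.succ (fun y => h3 g y i j) x)
          (fun l i j => pd l.succ (fun y => K3 g y i j) x) j
        - (pd j.succ (kappa g) x + pd j.succ (lieLogOmega g Ω) x) + sp (mom g G) x j := by
  have hJ := hA.frameJets hx
  have h1 := contract_cov_eq_divForm_three (fun i j => (h3 g x)⁻¹ i j) (K3 g x)
    (fun l i j => pd l.succ (fun y => h3 g y i j) x)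
    (fun l i j => pd l.succ (fun y => K3 g y i j) x)
    (hA.h3_inv_symm hx) hJ.tensor_symm hJ.metric_symm j
  rw [momentumConstraint, pd_congr hA.isOpen hx (fun y hy => hA.trace_K hy),
    pd_add (hA.diff hx hA.smooth_kappa) (hA.diff hx hA.smooth_lieLogOmega), ← h1]
  rfl

theorem pd_two_kT (hA : IsAdapted g G Ω U) (hx : x ∈ U) (A : Fin 2) (a : Fin 4) :
    pd a (fun y => kT g y A) x = 1 / 2 * ∑ B,
      (pd a (fun y => gammaHatS g y A B) x * onS₁ (lieShift g) x B
        + gammaHatS g x A B * pd a (fun y => onS₁ (lieShift g) y B) x) := by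
  have d1 := fun B => hA.diff hx (hA.smooth_gammaHatS A B)
  have d2 := fun B => hA.diff hx (hA.smooth_lieShift B)
  rw [pd_congr hA.isOpen hx (fun y hy => hA.kT_eq hy A),
    pd_const_mul _ (DifferentiableAt.fun_sum fun B _ => (d1 B).fun_mul (d2 B)),
    pd_sum _ fun B _ => (d1 B).fun_mul (d2 B)]
  simp only [pd_mul (d1 _) (d2 _)]

theorem mom_tangential (hA : IsAdapted g G Ω U) (hx : x ∈ U) (A : Fin 2) :
    ∑ l, mom g G x l * gammaHatMix g x l (idxS A) = mom g G x (idxS A) := by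
  have := hA.sum_gammaHatMix hx A (mom g G x)
  exact (Finset.sum_congr rfl fun _ _ => mul_comm _ _).trans this

end IsAdapted
end FoliatedSpacetime

namespace FoliatedSpacetime
namespace IsAdapted

variable {g G : Pt → Matrix (Fin 4) (Fin 4) ℝ} {Ω : Pt → ℝ} {U : Set Pt} {x : Pt}

/-- The shear terms of the tangential projection: the derivatives of the metric of `S_{τ,ρ}` along
`∂_ρ - N̂^A ∂_A` combine with `K̂_AB`. -/
theorem shift_terms (hA : IsAdapted g G Ω U) (hx : x ∈ U) (A : Fin 2) :
    (lapseHat g x ^ 2)⁻¹ * ∑ l, mVec g x l * pd l.succ (fun y => kT g y A) x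
      - (lapseHat g x ^ 2)⁻¹ *
        ∑ B, pd A.succ.succ (fun y => onS₁ (shiftHat g) y B) x * kT g x B
    = (2 * lapseHat g x)⁻¹ * ∑ j : Fin 3, onSigma (gammaHat g) x A.succ j *
        lieVec Fin.succ (sp (nHat g)) (sp (lieShift g)) x j
      + 2 * ∑ B, ∑ C, KHatS g x A B * (gammaHatS g x)⁻¹ B C * onS₁ (kCo g) x C := by
  have hL := (hA.lapseHat_pos hx).ne'
  have e : ∑ B, ∑ C, KHatS g x A B * (gammaHatS g x)⁻¹ B C * onS₁ (kCo g) x C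
      = (lapseHat g x)⁻¹ * ∑ B, KHatS g x A B * (1 / 2 * onS₁ (lieShift g) x B) := by
    simp only [← hA.sum_inv_kT hx, hA.kCo_eq hx, Fin.sum_univ_two]
    ring
  -- Here m(γ̂_AB) = 2N̂K̂_AB plus the lowered shift derivative and its transpose. The K̂ term
  -- becomes 2K̂_AB k^B, one shift term cancels the subtracted sum on the left, and the other
  -- completes the Lie bracket.
  rw [e, hA.lower_lie_nHat_lieShift hx]
  simp only [hA.KHatS_eq hx, hatK, hA.pd_two_kT hx, hA.kT_eq hx, pd_h3_succ, Fin.sum_univ_three,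
    Fin.sum_univ_two, idxS]
  rw [hA.gammaHatS_symm hx 1 0]
  field_simp
  ring

/-- Once the shift terms are rewritten by `shift_terms`, the half gradient in `div_KTF` accounts for
the change from the coefficient -1 of ∂_A(L_n ln Ω²) in the trace to -½. -/
theorem momentumConstraint_tangential (hA : IsAdapted g G Ω U) (hx : x ∈ U) (A : Fin 2) :
    momentumConstraint g G x A.succ = parConst g G Ω x A := by
  have hL := (hA.lapseHat_pos hx).ne'
  have hT := divForm_tangential hL (hA.isSplit hx) (hA.frameJets hx)
    (fun l B => hA.sum_inv_lower hx (fun A => pd l.succ (fun y => onS₁ (shiftHat g) y A) x) B) A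
  rw [hA.momentumConstraint_eq hx, hT, parConst, hA.div_KTF hx, hA.mom_tangential hx]
  simp only [← hA.KHatS_eq hx]
  have hs := hA.shift_terms hx A
  have e1 : ∑ B, ∑ C, nHatDot g x B.succ * (gammaHatS g x)⁻¹ B C * onS (KS g) x C A
      = -∑ B : Fin 2, ∑ C : Fin 2, (gammaHatS g x)⁻¹ B C *
          (pd B.succ.succ (lapseHat g) x / lapseHat g x) * K3 g x C.succ A.succ := by
    simp only [hA.nHatDot_eq hx, hA.KS_eq hx, ← Finset.sum_neg_distrib, idxS]
    exact Finset.sum_congr rfl fun _ _ => Finset.sum_congr rfl fun _ _ => by ring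
  rw [e1, hA.nHatDot_eq hx, hA.lieLogLapseHat_eq hx, hA.kCo_eq hx]
  have e2 : sp (mom g G) x A.succ = mom g G x (idxS A) := rfl
  have e3 : trKHat g x = ∑ B, ∑ C, (gammaHatS g x)⁻¹ B C * KHatS g x B C := rfl
  rw [e2, e3]
  simp only [idxS]
  linear_combination hs

/-- The divergence of `L_n N̂^A` on `S_{τ,ρ}`. -/
theorem div_lieShift (hA : IsAdapted g G Ω U) (hx : x ∈ U) :
    ∑ A, covVec idxS (gammaHatS g) (onS₁ (lieShift g)) x A A
      = 2 * (∑ A, ∑ B, (gammaHatS g x)⁻¹ A B * pd A.succ.succ (fun y => kT g y B) x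
        - ∑ A, ∑ B, (gammaHatS g x)⁻¹ A B * kT g x A *
          gammaTrace (fun A B => (gammaHatS g x)⁻¹ A B)
            (fun C A B => pd C.succ.succ (fun y => h3 g y A.succ B.succ) x) B) := by
  have h1 : ∑ A, ∑ B, (gammaHatS g x)⁻¹ A B * kT g x A *
          gammaTrace (fun A B => (gammaHatS g x)⁻¹ A B)
            (fun C A B => pd C.succ.succ (fun y => h3 g y A.succ B.succ) x) B
      = ∑ B, (1 / 2 * onS₁ (lieShift g) x B) *
          gammaTrace (fun A B => (gammaHatS g x)⁻¹ A B)
            (fun C A B => pd C.succ.succ (fun y => h3 g y A.succ B.succ) x) B := by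
    simp only [← hA.sum_inv_kT hx, Fin.sum_univ_two]
    rw [hA.gammaHatS_inv_symm hx 1 0]
    ring
  -- Inserting γ̂⁻¹γ̂ exposes lowered derivatives of L_n N̂, which match the Leibniz expansion of
  -- the derivative of `kT`.
  have h2 : ∑ A, pd (idxS A) (fun y => onS₁ (lieShift g) y A) x
      = ∑ A, ∑ B, (gammaHatS g x)⁻¹ A B * ∑ C, gammaHatS g x B C *
          pd (idxS A) (fun y => onS₁ (lieShift g) y C) x :=
    Finset.sum_congr rfl fun A _ =>
      hA.sum_inv_lower hx (fun C => pd (idxS A) (fun y => onS₁ (lieShift g) y C) x) A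
  rw [h1]
  simp only [covVec, Finset.sum_add_distrib, h2]
  simp only [christoffel, gammaTrace, hA.pd_two_kT hx, pd_h3_succ, Fin.sum_univ_two, idxS]
  simp only [hA.gammaHatS_inv_symm hx 1 0, hA.pd_gammaHatS_symm hx 1 0]
  ring

/-- The term m(κ) of the divergence cancels the one in the gradient of the trace, so κ enters
without any derivative. -/
theorem momentumConstraint_normal (hA : IsAdapted g G Ω U) (hx : x ∈ U) :
    (lapseHat g x)⁻¹ * ∑ j, mVec g x j * momentumConstraint g G x j = ortConst g G Ω x := by
  have hL := (hA.lapseHat_pos hx).ne'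
  have hT := divForm_normal hL (hA.isSplit hx) (hA.frameJets hx)
    (fun l B => hA.sum_inv_lower hx (fun A => pd l.succ (fun y => onS₁ (shiftHat g) y A) x) B)
  have hm : ∑ l, mom g G x l * nHat g x l
      = (lapseHat g x)⁻¹ * ∑ j, mVec g x j * sp (mom g G) x j :=
    (Finset.sum_congr rfl fun _ _ => mul_comm _ _).trans (hA.sum_nHat hx (mom g G x))
  have hs : ∑ j, mVec g x j * momentumConstraint g G x j
      = ∑ j, mVec g x j * divForm (fun i j => (h3 g x)⁻¹ i j) (K3 g x)
          (fun l i j => pd l.succ (fun y => h3 g y i j) x)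
          (fun l i j => pd l.succ (fun y => K3 g y i j) x) j
        - (∑ j, mVec g x j * pd j.succ (kappa g) x
          + ∑ j, mVec g x j * pd j.succ (lieLogOmega g Ω) x)
        + ∑ j, mVec g x j * sp (mom g G) x j := by
    simp only [hA.momentumConstraint_eq hx, mul_add, mul_sub, Finset.sum_add_distrib,
      Finset.sum_sub_distrib]
  have e3 : trKHat g x = ∑ B, ∑ C, (gammaHatS g x)⁻¹ B C * KHatS g x B C := rfl
  have hl : ∀ B, pd (idxS B) (fun y => Real.log (lapseHat g y)) x
      = pd (idxS B) (lapseHat g) x / lapseHat g x := fun B =>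
    pd_log (hA.diff hx hA.smooth_lapseHat) hL _
  rw [hs, hT, ortConst, hA.div_lieShift hx, hm, lieFun, hA.sum_sp_nHat hx, e3]
  simp only [hl]
  simp only [← hA.KHatS_eq hx, hA.KS_eq hx, hA.kCo_eq hx, idxS]
  generalize (∑ A, ∑ B, (gammaHatS g x)⁻¹ A B * kT g x A *
          gammaTrace (fun A B => (gammaHatS g x)⁻¹ A B)
            (fun C A B => pd C.succ.succ (fun y => h3 g y A.succ B.succ) x) B) = V
  have e4 : ∑ A : Fin 2, ∑ B : Fin 2, (gammaHatS g x)⁻¹ A B * ((lapseHat g x)⁻¹ * kT g x A) *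
      (pd B.succ.succ (lapseHat g) x / lapseHat g x)
      = (lapseHat g x)⁻¹ * ∑ A : Fin 2, ∑ B : Fin 2, (gammaHatS g x)⁻¹ A B * kT g x A *
        (pd B.succ.succ (lapseHat g) x / lapseHat g x) := by
    simp only [Fin.sum_univ_two]
    ring
  rw [e4]
  generalize (∑ A : Fin 2, ∑ B : Fin 2, (gammaHatS g x)⁻¹ A B * kT g x A *
        (pd B.succ.succ (lapseHat g) x / lapseHat g x)) = X
  generalize (∑ A, ∑ B, ∑ C, ∑ D, (gammaHatS g x)⁻¹ A C * (gammaHatS g x)⁻¹ B D *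
        K3 g x A.succ B.succ * KHatS g x C D) = Y
  field_simp
  ring

theorem momentumConstraint_iff (hA : IsAdapted g G Ω U) (hx : x ∈ U) :
    (∀ j, momentumConstraint g G x j = 0) ↔
      (∀ A, parConst g G Ω x A = 0) ∧ ortConst g G Ω x = 0 := by
  have hL := (hA.lapseHat_pos hx).ne'
  have hn := hA.momentumConstraint_normal hx
  constructor
  · intro hM
    refine ⟨fun A => by rw [← hA.momentumConstraint_tangential hx, hM], ?_⟩
    rw [← hn]
    simp [hM]
  · rintro ⟨hP, hO⟩
    have ht : ∀ A : Fin 2, momentumConstraint g G x A.succ = 0 := fun A => by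
      rw [hA.momentumConstraint_tangential hx, hP]
    -- As m has ρ-component 1, the ρ-component of the constraint is its contraction with m once the
    -- tangential components vanish.
    rw [hO, sum_mVec] at hn
    simp only [ht, mul_zero, Finset.sum_const_zero, sub_zero, mul_eq_zero, inv_eq_zero, hL,
      false_or] at hn
    exact fun j => Fin.cases hn ht j

end IsAdapted
end FoliatedSpacetime

namespace FoliatedSpacetime

/-! ### The source term of the first order system -/

namespace SurfaceData

noncomputable section

/-- `γ̂_AB = Ω² γ_AB`. -/
def met (q : SurfaceData) : Matrix (Fin 2) (Fin 2) ℝ :=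
  Matrix.of fun A B => q.1.1 ^ 2 * q.1.2.1 A B

/-- `∂_C γ̂_AB`. -/
def metDeriv (q : SurfaceData) (C A B : Fin 2) : ℝ :=
  2 * q.1.1 * (q.2.1 C).1 * q.1.2.1 A B + q.1.1 ^ 2 * (q.2.1 C).2.1 A B

/-- The Christoffel symbols of `γ̂_AB`. -/
def christoffelS (q : SurfaceData) (C A B : Fin 2) : ℝ :=
  (1 / 2) * ∑ D, (met q)⁻¹ C D * (metDeriv q A B D + metDeriv q B A D - metDeriv q D A B)

/-- The trace free part of the tangential extrinsic curvature. -/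
def traceFree (q : SurfaceData) (A B : Fin 2) : ℝ :=
  1 / 2 * (q.1.1 ^ 2 * q.1.2.2.2.2.2 A B)

/-- The tangential derivatives of `traceFree`. -/
def traceFreeDeriv (q : SurfaceData) (C A B : Fin 2) : ℝ :=
  1 / 2 * (2 * q.1.1 * (q.2.1 C).1 * q.1.2.2.2.2.2 A B
    + q.1.1 ^ 2 * (q.2.1 C).2.2.2.2.2 A B)

/-- `D̂_A ln N̂`. -/
def gradLogLapse (q : SurfaceData) (A : Fin 2) : ℝ := (q.2.1 A).2.2.1 / q.1.2.2.1

/-- `κ = L_n ln N̂`. -/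
def normalCurv (q : SurfaceData) : ℝ := q.1.2.2.2.2.1 / q.1.2.2.1

/-- The tangential derivatives of `normalCurv`. -/
def normalCurvDeriv (q : SurfaceData) (A : Fin 2) : ℝ :=
  (q.2.1 A).2.2.2.2.1 / q.1.2.2.1 - normalCurv q * gradLogLapse q A

/-- The trace of `K̂_AB`. -/
def trHat (q : SurfaceData) : ℝ := ∑ A, ∑ B, (met q)⁻¹ A B * q.2.2.1 A B

/-- The covector `k_A`. -/
def mixedCurv (q : SurfaceData) (u : Comp → ℝ) (A : Fin 2) : ℝ :=
  q.1.2.2.1⁻¹ * (1 / 2 * ∑ B, met q A B * u (Sum.inl B))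

/-- The tangential extrinsic curvature. -/
def tangCurv (q : SurfaceData) (u : Comp → ℝ) (A B : Fin 2) : ℝ :=
  1 / 2 * (q.1.1 ^ 2 * q.1.2.2.2.2.2 A B + met q A B * u (Sum.inr ()))

/-- The terms of the tangential projection without derivatives of the unknown. -/
def sourcePar (q : SurfaceData) (u : Comp → ℝ) (A : Fin 2) : ℝ :=
  trHat q * mixedCurv q u A
    + ∑ B, ∑ C, (met q)⁻¹ B C * (traceFreeDeriv q B C A
      - ∑ D, christoffelS q D B C * traceFree q D A - ∑ D, christoffelS q D B A * traceFree q C D)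
    + normalCurv q * -gradLogLapse q A
    + (2 * q.1.2.2.1)⁻¹ * (q.1.2.2.1⁻¹ * ∑ C, u (Sum.inl C) *
      ∑ B, met q A B * (q.2.1 C).2.2.2.1 B)
    + 2 * ∑ B, ∑ C, q.2.2.1 A B * (met q)⁻¹ B C * mixedCurv q u C
    - q.2.2.2.1 * mixedCurv q u A
    - ∑ B, ∑ C, -gradLogLapse q B * (met q)⁻¹ B C * tangCurv q u C A
    - normalCurvDeriv q A
    + q.2.2.2.2.1 A

/-- The terms of the normal projection without derivatives of the unknown. -/
def sourceOrt (q : SurfaceData) (u : Comp → ℝ) : ℝ :=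
  normalCurv q * trHat q
    - ∑ A, ∑ B, ∑ C, ∑ D, (met q)⁻¹ A C * (met q)⁻¹ B D * tangCurv q u A B * q.2.2.1 C D
    + (2 * q.1.2.2.1)⁻¹ * ∑ A, ∑ B, christoffelS q A A B * u (Sum.inl B)
    + ∑ A, ∑ B, (met q)⁻¹ A B * mixedCurv q u A * gradLogLapse q B
    + q.2.2.2.2.2

/-- The source term of the first order system. -/
def source (p : SurfaceData × (Comp → ℝ)) : Comp → ℝ :=
  Sum.elim (fun A => 2 * sourcePar p.1 p.2 A) (fun _ => -2 * p.1.1.2.2.1 * sourceOrt p.1 p.2)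

end

end SurfaceData

open SurfaceData

theorem lapse_ne_zero_of_admissible {q : SurfaceData} (hq : q ∈ admissible) : q.1.2.2.1 ≠ 0 :=
  hq.2.2.ne'

/-- The determinant of γ̂ is a power of Ω² times det γ, so admissibility is what makes γ̂⁻¹ smooth
in the data. -/
theorem det_met_ne_zero {q : SurfaceData} (hq : q ∈ admissible) : (met q).det ≠ 0 := by
  have e : met q = (q.1.1 ^ 2) • SurfaceData.gamma q := by
    ext A B; simp [met, SurfaceData.gamma]
  rw [e, Matrix.det_smul]
  exact mul_ne_zero (pow_ne_zero _ (pow_ne_zero _ hq.1)) hq.2.1.ne'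

/-! ### Smooth dependence on the surface data and the unknown -/

theorem contDiffOn_coeffRho (c d : Comp) :
    ContDiffOn ℝ ∞ (fun q => coeffRho q c d) admissible := by
  have hL : ContDiffOn ℝ ∞ (fun q : SurfaceData => (q.1.2.2.1 ^ 2)⁻¹) admissible :=
    ContDiffOn.inv (by fun_prop) fun q hq => pow_ne_zero 2 (lapse_ne_zero_of_admissible hq)
  rcases c with A | _ <;> rcases d with B | _
  · simp only [coeffRho, Matrix.fromBlocks_apply₁₁, Matrix.smul_apply, smul_eq_mul,
      SurfaceData.lapse, SurfaceData.conf, SurfaceData.gamma, Matrix.of_apply]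
    exact hL.mul (by fun_prop)
  · simpa [coeffRho] using contDiffOn_const
  · simpa [coeffRho] using contDiffOn_const
  · simpa [coeffRho] using contDiffOn_const

theorem contDiffOn_coeffTan (k : Fin 2) (c d : Comp) :
    ContDiffOn ℝ ∞ (fun q => coeffTan q k c d) admissible := by
  have hL : ContDiffOn ℝ ∞ (fun q : SurfaceData => (q.1.2.2.1 ^ 2)⁻¹) admissible :=
    ContDiffOn.inv (by fun_prop) fun q hq => pow_ne_zero 2 (lapse_ne_zero_of_admissible hq)
  rcases c with A | _ <;> rcases d with B | _
  · simp only [coeffTan, Matrix.fromBlocks_apply₁₁, Matrix.neg_apply, Matrix.smul_apply,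
      smul_eq_mul, SurfaceData.lapse, SurfaceData.conf, SurfaceData.gamma, SurfaceData.shift,
      Matrix.of_apply, div_eq_mul_inv]
    exact ((ContDiffOn.mul (by fun_prop) hL).mul (by fun_prop)).neg
  · simpa [coeffTan] using contDiffOn_const
  · simpa [coeffTan] using contDiffOn_const
  · simp only [coeffTan, Matrix.fromBlocks_apply₂₂, Matrix.of_apply, SurfaceData.shift]
    fun_prop

theorem contDiffOn_met (A B : Fin 2) :
    ContDiffOn ℝ ∞ (fun p : SurfaceData × (Comp → ℝ) => met p.1 A B) (admissible ×ˢ Set.univ) := by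
  simp only [met, Matrix.of_apply]
  fun_prop

theorem contDiffOn_met_inv (A B : Fin 2) :
    ContDiffOn ℝ ∞ (fun p : SurfaceData × (Comp → ℝ) => (met p.1)⁻¹ A B) (admissible ×ˢ Set.univ) :=
  smooth_matrix_inv contDiffOn_met (fun _ hp => det_met_ne_zero hp.1) A B

theorem contDiffOn_lapse_inv :
    ContDiffOn ℝ ∞ (fun p : SurfaceData × (Comp → ℝ) => (p.1.1.2.2.1)⁻¹) (admissible ×ˢ Set.univ) :=
  ContDiffOn.inv (by fun_prop) fun _ hp => lapse_ne_zero_of_admissible hp.1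

theorem contDiffOn_metDeriv (C A B : Fin 2) :
    ContDiffOn ℝ ∞ (fun p : SurfaceData × (Comp → ℝ) => metDeriv p.1 C A B)
      (admissible ×ˢ Set.univ) := by
  simp only [metDeriv]
  fun_prop

theorem contDiffOn_christoffelS (C A B : Fin 2) :
    ContDiffOn ℝ ∞ (fun p : SurfaceData × (Comp → ℝ) => christoffelS p.1 C A B)
      (admissible ×ˢ Set.univ) :=
  contDiffOn_const.mul (ContDiffOn.sum fun D _ => (contDiffOn_met_inv C D).mul
    (((contDiffOn_metDeriv A B D).add (contDiffOn_metDeriv B A D)).sub (contDiffOn_metDeriv D A B)))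

theorem contDiffOn_traceFree (A B : Fin 2) :
    ContDiffOn ℝ ∞ (fun p : SurfaceData × (Comp → ℝ) => traceFree p.1 A B)
      (admissible ×ˢ Set.univ) := by
  simp only [traceFree]
  fun_prop

theorem contDiffOn_traceFreeDeriv (C A B : Fin 2) :
    ContDiffOn ℝ ∞ (fun p : SurfaceData × (Comp → ℝ) => traceFreeDeriv p.1 C A B)
      (admissible ×ˢ Set.univ) := by
  simp only [traceFreeDeriv]
  fun_prop

theorem contDiffOn_gradLogLapse (A : Fin 2) :
    ContDiffOn ℝ ∞ (fun p : SurfaceData × (Comp → ℝ) => gradLogLapse p.1 A)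
      (admissible ×ˢ Set.univ) := by
  have := contDiffOn_lapse_inv
  simp only [gradLogLapse, div_eq_mul_inv]
  fun_prop

theorem contDiffOn_normalCurv :
    ContDiffOn ℝ ∞ (fun p : SurfaceData × (Comp → ℝ) => normalCurv p.1)
      (admissible ×ˢ Set.univ) := by
  have := contDiffOn_lapse_inv
  simp only [normalCurv, div_eq_mul_inv]
  fun_prop

theorem contDiffOn_normalCurvDeriv (A : Fin 2) :
    ContDiffOn ℝ ∞ (fun p : SurfaceData × (Comp → ℝ) => normalCurvDeriv p.1 A)
      (admissible ×ˢ Set.univ) := by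
  have := contDiffOn_lapse_inv
  have := contDiffOn_normalCurv
  have := contDiffOn_gradLogLapse
  simp only [normalCurvDeriv, div_eq_mul_inv]
  fun_prop

theorem contDiffOn_trHat :
    ContDiffOn ℝ ∞ (fun p : SurfaceData × (Comp → ℝ) => trHat p.1) (admissible ×ˢ Set.univ) :=
  ContDiffOn.sum fun A _ => ContDiffOn.sum fun B _ => (contDiffOn_met_inv A B).mul (by fun_prop)

theorem contDiffOn_mixedCurv (A : Fin 2) :
    ContDiffOn ℝ ∞ (fun p : SurfaceData × (Comp → ℝ) => mixedCurv p.1 p.2 A)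
      (admissible ×ˢ Set.univ) :=
  contDiffOn_lapse_inv.mul (contDiffOn_const.mul
    (ContDiffOn.sum fun B _ => (contDiffOn_met A B).mul (by fun_prop)))

theorem contDiffOn_tangCurv (A B : Fin 2) :
    ContDiffOn ℝ ∞ (fun p : SurfaceData × (Comp → ℝ) => tangCurv p.1 p.2 A B)
      (admissible ×ˢ Set.univ) :=
  contDiffOn_const.mul (ContDiffOn.add (by fun_prop) ((contDiffOn_met A B).mul (by fun_prop)))

theorem contDiffOn_two_lapse_inv :
    ContDiffOn ℝ ∞ (fun p : SurfaceData × (Comp → ℝ) => (2 * p.1.1.2.2.1)⁻¹)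
      (admissible ×ˢ Set.univ) :=
  ContDiffOn.inv (by fun_prop) fun _ hp =>
    mul_ne_zero two_ne_zero (lapse_ne_zero_of_admissible hp.1)

theorem contDiffOn_sourcePar (A : Fin 2) :
    ContDiffOn ℝ ∞ (fun p : SurfaceData × (Comp → ℝ) => sourcePar p.1 p.2 A)
      (admissible ×ˢ Set.univ) := by
  have h1 := contDiffOn_trHat.mul (contDiffOn_mixedCurv A)
  have h2 : ContDiffOn ℝ ∞ (fun p : SurfaceData × (Comp → ℝ) =>
      ∑ B, ∑ C, (met p.1)⁻¹ B C * (traceFreeDeriv p.1 B C A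
      - ∑ D, christoffelS p.1 D B C * traceFree p.1 D A
      - ∑ D, christoffelS p.1 D B A * traceFree p.1 C D)) (admissible ×ˢ Set.univ) :=
    ContDiffOn.sum fun B _ => ContDiffOn.sum fun C _ => (contDiffOn_met_inv B C).mul
      (((contDiffOn_traceFreeDeriv B C A).sub (ContDiffOn.sum fun D _ =>
        (contDiffOn_christoffelS D B C).mul (contDiffOn_traceFree D A))).sub
        (ContDiffOn.sum fun D _ => (contDiffOn_christoffelS D B A).mul (contDiffOn_traceFree C D)))
  have h3 := contDiffOn_normalCurv.mul (contDiffOn_gradLogLapse A).neg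
  have h4 : ContDiffOn ℝ ∞ (fun p : SurfaceData × (Comp → ℝ) =>
      (2 * p.1.1.2.2.1)⁻¹ * (p.1.1.2.2.1⁻¹ * ∑ C, p.2 (Sum.inl C) *
      ∑ B, met p.1 A B * (p.1.2.1 C).2.2.2.1 B)) (admissible ×ˢ Set.univ) :=
    contDiffOn_two_lapse_inv.mul (contDiffOn_lapse_inv.mul (ContDiffOn.sum fun C _ =>
      ContDiffOn.mul (by fun_prop) (ContDiffOn.sum fun B _ =>
        (contDiffOn_met A B).mul (by fun_prop))))
  have h5 : ContDiffOn ℝ ∞ (fun p : SurfaceData × (Comp → ℝ) =>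
      2 * ∑ B, ∑ C, p.1.2.2.1 A B * (met p.1)⁻¹ B C * mixedCurv p.1 p.2 C)
      (admissible ×ˢ Set.univ) :=
    contDiffOn_const.mul (ContDiffOn.sum fun B _ => ContDiffOn.sum fun C _ =>
      (ContDiffOn.mul (by fun_prop) (contDiffOn_met_inv B C)).mul (contDiffOn_mixedCurv C))
  have h6 : ContDiffOn ℝ ∞ (fun p : SurfaceData × (Comp → ℝ) =>
      p.1.2.2.2.1 * mixedCurv p.1 p.2 A) (admissible ×ˢ Set.univ) :=
    ContDiffOn.mul (by fun_prop) (contDiffOn_mixedCurv A)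
  have h7 : ContDiffOn ℝ ∞ (fun p : SurfaceData × (Comp → ℝ) =>
      ∑ B, ∑ C, -gradLogLapse p.1 B * (met p.1)⁻¹ B C * tangCurv p.1 p.2 C A)
      (admissible ×ˢ Set.univ) :=
    ContDiffOn.sum fun B _ => ContDiffOn.sum fun C _ =>
      ((contDiffOn_gradLogLapse B).neg.mul (contDiffOn_met_inv B C)).mul (contDiffOn_tangCurv C A)
  have h8 : ContDiffOn ℝ ∞ (fun p : SurfaceData × (Comp → ℝ) => p.1.2.2.2.2.1 A)
      (admissible ×ˢ Set.univ) := by fun_prop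
  exact (((((((h1.add h2).add h3).add h4).add h5).sub h6).sub h7).sub
    (contDiffOn_normalCurvDeriv A)).add h8

theorem contDiffOn_sourceOrt :
    ContDiffOn ℝ ∞ (fun p : SurfaceData × (Comp → ℝ) => sourceOrt p.1 p.2)
      (admissible ×ˢ Set.univ) := by
  have h1 := contDiffOn_normalCurv.mul contDiffOn_trHat
  have h2 : ContDiffOn ℝ ∞ (fun p : SurfaceData × (Comp → ℝ) =>
      ∑ A, ∑ B, ∑ C, ∑ D, (met p.1)⁻¹ A C * (met p.1)⁻¹ B D * tangCurv p.1 p.2 A B *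
        p.1.2.2.1 C D) (admissible ×ˢ Set.univ) :=
    ContDiffOn.sum fun A _ => ContDiffOn.sum fun B _ => ContDiffOn.sum fun C _ =>
      ContDiffOn.sum fun D _ => (((contDiffOn_met_inv A C).mul (contDiffOn_met_inv B D)).mul
        (contDiffOn_tangCurv A B)).mul (by fun_prop)
  have h3 : ContDiffOn ℝ ∞ (fun p : SurfaceData × (Comp → ℝ) =>
      (2 * p.1.1.2.2.1)⁻¹ * ∑ A, ∑ B, christoffelS p.1 A A B * p.2 (Sum.inl B))
      (admissible ×ˢ Set.univ) :=
    contDiffOn_two_lapse_inv.mul (ContDiffOn.sum fun A _ => ContDiffOn.sum fun B _ =>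
      (contDiffOn_christoffelS A A B).mul (by fun_prop))
  have h4 : ContDiffOn ℝ ∞ (fun p : SurfaceData × (Comp → ℝ) =>
      ∑ A, ∑ B, (met p.1)⁻¹ A B * mixedCurv p.1 p.2 A * gradLogLapse p.1 B)
      (admissible ×ˢ Set.univ) :=
    ContDiffOn.sum fun A _ => ContDiffOn.sum fun B _ =>
      ((contDiffOn_met_inv A B).mul (contDiffOn_mixedCurv A)).mul (contDiffOn_gradLogLapse B)
  have h5 : ContDiffOn ℝ ∞ (fun p : SurfaceData × (Comp → ℝ) => p.1.2.2.2.2.2)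
      (admissible ×ˢ Set.univ) := by fun_prop
  exact (((h1.sub h2).add h3).add h4).add h5

theorem contDiffOn_source : ContDiffOn ℝ ∞ source (admissible ×ˢ Set.univ) := by
  refine contDiffOn_pi.2 fun c => ?_
  rcases c with A | _
  · exact contDiffOn_const.mul (contDiffOn_sourcePar A)
  · exact ContDiffOn.mul (by fun_prop) contDiffOn_sourceOrt

end FoliatedSpacetime

namespace FoliatedSpacetime

open SurfaceData

namespace IsAdapted

variable {g G : Pt → Matrix (Fin 4) (Fin 4) ℝ} {Ω : Pt → ℝ} {U : Set Pt} {x : Pt}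

/-! ### The source term on a spacetime -/

theorem met_surfaceData (hA : IsAdapted g G Ω U) (hx : x ∈ U) :
    met (surfaceData g G Ω x) = gammaHatS g x := by
  ext A B
  exact (hA.gammaHat_eq_conf hx A B).symm

theorem metDeriv_surfaceData (hA : IsAdapted g G Ω U) (hx : x ∈ U) (C A B : Fin 2) :
    metDeriv (surfaceData g G Ω x) C A B = pd (idxS C) (fun y => gammaHatS g y A B) x :=
  (hA.pd_gammaHatS hx A B (idxS C)).symm

theorem christoffelS_surfaceData (hA : IsAdapted g G Ω U) (hx : x ∈ U) (C A B : Fin 2) :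
    christoffelS (surfaceData g G Ω x) C A B = christoffel idxS (gammaHatS g) x C A B := by
  simp only [christoffelS, christoffel, hA.met_surfaceData hx, hA.metDeriv_surfaceData hx]

theorem traceFree_surfaceData (hA : IsAdapted g G Ω U) (hx : x ∈ U) (A B : Fin 2) :
    traceFree (surfaceData g G Ω x) A B = onS (KTF g) x A B :=
  (hA.KTF_eq_conf hx A B).symm

theorem traceFreeDeriv_surfaceData (hA : IsAdapted g G Ω U) (hx : x ∈ U) (C A B : Fin 2) :
    traceFreeDeriv (surfaceData g G Ω x) C A B
      = pd (idxS C) (fun y => onS (KTF g) y A B) x := by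
  have d := hA.diff hx hA.smooth_conf
  have d2 := hA.diff hx (hA.smooth_lieConf A B)
  have e : ∀ y ∈ U, onS (KTF g) y A B = 1 / 2 * (Ω y * Ω y *
      onS (lieTensor id (normal g) (gammaConf g Ω)) y A B) := fun y hy => by
    rw [hA.KTF_eq_conf hy, sq]
  rw [pd_congr hA.isOpen hx e, pd_const_mul _ ((d.fun_mul d).fun_mul d2),
    pd_mul (d.fun_mul d) d2, pd_mul d d]
  simp only [traceFreeDeriv, surfaceData, surfaceFields, surfaceFieldsDeriv]
  ring

theorem gradLogLapse_surfaceData (g G : Pt → Matrix (Fin 4) (Fin 4) ℝ) (Ω : Pt → ℝ) (x : Pt)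
    (A : Fin 2) :
    gradLogLapse (surfaceData g G Ω x) A = pd (idxS A) (lapseHat g) x / lapseHat g x := rfl

theorem normalCurv_surfaceData (hA : IsAdapted g G Ω U) (hx : x ∈ U) :
    normalCurv (surfaceData g G Ω x) = kappa g x :=
  (hA.kappa_eq_conf hx).symm

theorem normalCurvDeriv_surfaceData (hA : IsAdapted g G Ω U) (hx : x ∈ U) (A : Fin 2) :
    normalCurvDeriv (surfaceData g G Ω x) A = pd (idxS A) (kappa g) x := by
  have hL := (hA.lapseHat_pos hx).ne'
  -- Differentiating the product L_n N̂ = κN̂ and solving for ∂_A κ replaces the quotient rule.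
  have e : ∀ y ∈ U, lieFun id (normal g) (lapseHat g) y = kappa g y * lapseHat g y :=
    fun y hy => by
      rw [hA.kappa_eq_conf hy, div_mul_cancel₀ _ (hA.lapseHat_pos hy).ne']
  have h1 := pd_congr hA.isOpen hx e (idxS A)
  rw [pd_mul (hA.diff hx hA.smooth_kappa) (hA.diff hx hA.smooth_lapseHat)] at h1
  rw [normalCurvDeriv, hA.normalCurv_surfaceData hx, gradLogLapse_surfaceData]
  change pd (idxS A) (lieFun id (normal g) (lapseHat g)) x / lapseHat g x - _ = _
  rw [h1]
  field_simp
  ring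

theorem trHat_surfaceData (hA : IsAdapted g G Ω U) (hx : x ∈ U) :
    trHat (surfaceData g G Ω x) = trKHat g x := by
  simp only [trHat, trKHat, hA.met_surfaceData hx]
  rfl

theorem mixedCurv_surfaceData (hA : IsAdapted g G Ω U) (hx : x ∈ U) (A : Fin 2) :
    mixedCurv (surfaceData g G Ω x) (unknown g Ω x) A = onS₁ (kCo g) x A := by
  rw [hA.kCo_eq hx, hA.kT_eq hx, mixedCurv, hA.met_surfaceData hx]
  rfl

theorem tangCurv_surfaceData (hA : IsAdapted g G Ω U) (hx : x ∈ U) (A B : Fin 2) :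
    tangCurv (surfaceData g G Ω x) (unknown g Ω x) A B = onS (KS g) x A B := by
  rw [hA.KS_eq hx, hA.K3_tangential hx, tangCurv, hA.met_surfaceData hx]
  rfl

/-- Isolates the derivatives of the unknown. The gradient of κ and the divergence of the trace free
part belong to the source, since both come from data and their tangential derivatives. -/
theorem parConst_eq (hA : IsAdapted g G Ω U) (hx : x ∈ U) (A : Fin 2) :
    parConst g G Ω x A = sourcePar (surfaceData g G Ω x) (unknown g Ω x) A
      + (2 * lapseHat g x)⁻¹ * ((lapseHat g x)⁻¹ * ∑ B, gammaHatS g x A B *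
          ∑ l, mVec g x l * pd l.succ (fun y => onS₁ (lieShift g) y B) x)
      - 1 / 2 * pd (idxS A) (lieLogOmega g Ω) x := by
  have f1 : (surfaceData g G Ω x).1.2.2.1 = lapseHat g x := rfl
  have f2 : ∀ C, unknown g Ω x (Sum.inl C) = onS₁ (lieShift g) x C := fun _ => rfl
  have f3 : ∀ C B, ((surfaceData g G Ω x).2.1 C).2.2.2.1 B
      = pd (idxS C) (fun y => onS₁ (shiftHat g) y B) x := fun _ _ => rfl
  have f4 : ∀ A B, (surfaceData g G Ω x).2.2.1 A B = KHatS g x A B := fun _ _ => rfl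
  have f5 : (surfaceData g G Ω x).2.2.2.1 = lieLogLapseHat g x := rfl
  have f6 : (surfaceData g G Ω x).2.2.2.2.1 A = mom g G x (idxS A) := rfl
  rw [parConst, sourcePar, hA.lower_lie_nHat_lieShift hx, hA.mom_tangential hx]
  simp only [hA.met_surfaceData hx, hA.christoffelS_surfaceData hx,
    hA.traceFree_surfaceData hx, hA.traceFreeDeriv_surfaceData hx, gradLogLapse_surfaceData,
    hA.normalCurv_surfaceData hx, hA.normalCurvDeriv_surfaceData hx, hA.trHat_surfaceData hx,
    hA.mixedCurv_surfaceData hx, hA.tangCurv_surfaceData hx, hA.nHatDot_eq hx, f1, f2, f3, f4, f5,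
    f6, covTensor]
  ring

/-- The surface divergence of L_n N̂ splits into coordinate derivatives, which are principal, and a
Christoffel term, which is algebraic in the unknown. -/
theorem ortConst_eq (hA : IsAdapted g G Ω U) (hx : x ∈ U) :
    ortConst g G Ω x = sourceOrt (surfaceData g G Ω x) (unknown g Ω x)
      + (2 * lapseHat g x)⁻¹ * ∑ A, pd (idxS A) (fun y => onS₁ (lieShift g) y A) x
      - (lapseHat g x)⁻¹ * ∑ l, mVec g x l * pd l.succ (lieLogOmega g Ω) x := by
  have f1 : (surfaceData g G Ω x).1.2.2.1 = lapseHat g x := rfl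
  have f2 : ∀ C, unknown g Ω x (Sum.inl C) = onS₁ (lieShift g) x C := fun _ => rfl
  have f4 : ∀ A B, (surfaceData g G Ω x).2.2.1 A B = KHatS g x A B := fun _ _ => rfl
  have f6 : (surfaceData g G Ω x).2.2.2.2.2 = ∑ l, mom g G x l * nHat g x l := rfl
  have hl : ∀ B, pd (idxS B) (fun y => Real.log (lapseHat g y)) x
      = pd (idxS B) (lapseHat g) x / lapseHat g x := fun B =>
    pd_log (hA.diff hx hA.smooth_lapseHat) (hA.lapseHat_pos hx).ne' _
  rw [ortConst, sourceOrt, lieFun, hA.sum_sp_nHat hx]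
  simp only [hA.met_surfaceData hx, hA.christoffelS_surfaceData hx, gradLogLapse_surfaceData,
    hA.normalCurv_surfaceData hx, hA.trHat_surfaceData hx,
    hA.mixedCurv_surfaceData hx, hA.tangCurv_surfaceData hx, f1, f2, f4, f6, hl, covVec,
    Finset.sum_add_distrib]
  ring

/-! ### The first order system -/

theorem coeffRho_surfaceData (hA : IsAdapted g G Ω U) (hx : x ∈ U) :
    coeffRho (surfaceData g G Ω x)
      = Matrix.fromBlocks ((lapseHat g x ^ 2)⁻¹ • gammaHatS g x) 0 0 (Matrix.of fun _ _ => 2) := by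
  rw [← hA.met_surfaceData hx]
  rfl

theorem coeffTan_surfaceData (hA : IsAdapted g G Ω U) (hx : x ∈ U) (k : Fin 2) :
    coeffTan (surfaceData g G Ω x) k
      = Matrix.fromBlocks (-((onS₁ (shiftHat g) x k / lapseHat g x ^ 2) • gammaHatS g x))
        (Matrix.of fun A _ => -(1 : Matrix (Fin 2) (Fin 2) ℝ) A k)
        (Matrix.of fun _ B => -(1 : Matrix (Fin 2) (Fin 2) ℝ) B k)
        (Matrix.of fun _ _ => -(2 * onS₁ (shiftHat g) x k)) := by
  rw [← hA.met_surfaceData hx]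
  rfl

theorem two_mul_parConst (hA : IsAdapted g G Ω U) (hx : x ∈ U) (A : Fin 2) :
    2 * parConst g G Ω x A
      = system source (surfaceData g G Ω) (unknown g Ω) x (Sum.inl A) := by
  have hL := (hA.lapseHat_pos hx).ne'
  have hsrc : source (surfaceData g G Ω x, unknown g Ω x) (Sum.inl A)
      = 2 * sourcePar (surfaceData g G Ω x) (unknown g Ω x) A := rfl
  have f2 : ∀ C, (fun y => unknown g Ω y (Sum.inl C)) = fun y => onS₁ (lieShift g) y C :=
    fun _ => rfl
  have f3 : (fun y => unknown g Ω y (Sum.inr ())) = lieLogOmega g Ω := rfl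
  -- Writing the gradient with a Kronecker delta produces the block -δ_A^K after doubling.
  have hδ : pd (idxS A) (lieLogOmega g Ω) x
      = ∑ k, (1 : Matrix (Fin 2) (Fin 2) ℝ) A k * pd (idxS k) (lieLogOmega g Ω) x := by
    simp [Matrix.one_apply]
  rw [hA.parConst_eq hx, hδ]
  simp only [system, Pi.add_apply, Matrix.mulVec, dotProduct,
    Fintype.sum_sum_type, hA.coeffRho_surfaceData hx, hA.coeffTan_surfaceData hx,
    Matrix.fromBlocks_apply₁₁, Matrix.fromBlocks_apply₁₂, Matrix.smul_apply, Matrix.neg_apply,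
    Matrix.of_apply, Matrix.zero_apply, smul_eq_mul, Finset.univ_unique, Finset.sum_singleton,
    PUnit.default_eq_unit, f2, f3, hsrc, sum_mVec, Fin.sum_univ_two, Fin.succ_zero_eq_one, idxS]
  field_simp
  ring

theorem neg_two_mul_ortConst (hA : IsAdapted g G Ω U) (hx : x ∈ U) :
    -2 * lapseHat g x * ortConst g G Ω x
      = system source (surfaceData g G Ω) (unknown g Ω) x (Sum.inr ()) := by
  have hL := (hA.lapseHat_pos hx).ne'
  have hsrc : source (surfaceData g G Ω x, unknown g Ω x) (Sum.inr ())
      = -2 * lapseHat g x * sourceOrt (surfaceData g G Ω x) (unknown g Ω x) := rfl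
  have f2 : ∀ C, (fun y => unknown g Ω y (Sum.inl C)) = fun y => onS₁ (lieShift g) y C :=
    fun _ => rfl
  have f3 : (fun y => unknown g Ω y (Sum.inr ())) = lieLogOmega g Ω := rfl
  have o1 : (1 : Matrix (Fin 2) (Fin 2) ℝ) 0 1 = 0 := by simp
  have o2 : (1 : Matrix (Fin 2) (Fin 2) ℝ) 1 0 = 0 := by simp
  rw [hA.ortConst_eq hx]
  simp only [system, Pi.add_apply, Matrix.mulVec, dotProduct,
    Fintype.sum_sum_type, hA.coeffRho_surfaceData hx, hA.coeffTan_surfaceData hx,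
    Matrix.fromBlocks_apply₂₁, Matrix.fromBlocks_apply₂₂,
    Matrix.of_apply, Matrix.zero_apply, Finset.univ_unique, Finset.sum_singleton,
    PUnit.default_eq_unit, f2, f3, hsrc, sum_mVec, Fin.sum_univ_two, Fin.succ_zero_eq_one, idxS,
    Matrix.one_apply_eq, o1, o2]
  field_simp
  ring

theorem surfaceData_mem_admissible (hA : IsAdapted g G Ω U) (hx : x ∈ U) :
    surfaceData g G Ω x ∈ admissible := by
  refine ⟨hA.conf_ne_zero x hx, ?_, hA.lapseHat_pos hx⟩
  have h0 := hA.conf_ne_zero x hx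
  have e : SurfaceData.gamma (surfaceData g G Ω x) = (Ω x ^ 2)⁻¹ • gammaHatS g x := by
    ext A B
    rw [Matrix.smul_apply, smul_eq_mul, hA.gammaHat_eq_conf hx,
      inv_mul_cancel_left₀ (pow_ne_zero 2 h0)]
    rfl
  rw [e, Matrix.det_smul]
  exact mul_pos (by positivity) (hA.gammaHatS_posDef hx).det_pos

theorem isSymmetricHyperbolic (hA : IsAdapted g G Ω U) (hx : x ∈ U) :
    IsSymmetricHyperbolic (coeffRho (surfaceData g G Ω x)) (coeffTan (surfaceData g G Ω x)) := by
  have hL := hA.lapseHat_pos hx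
  have hq : (gammaHatS g x).IsSymm := by
    ext A B; exact hA.gammaHatS_symm hx B A
  have hsymm : (coeffRho (surfaceData g G Ω x)).IsSymm := by
    rw [hA.coeffRho_surfaceData hx]
    refine Matrix.IsSymm.fromBlocks (hq.smul _) (by simp) ?_
    ext; rfl
  refine ⟨hsymm, fun k => ?_, ?_⟩
  · rw [hA.coeffTan_surfaceData hx]
    refine Matrix.IsSymm.fromBlocks ((hq.smul _).neg) ?_ ?_
    · ext A B; rfl
    · ext; rfl
  · refine Matrix.PosDef.of_dotProduct_mulVec_pos ?_ fun v hv => ?_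
    · rw [Matrix.IsHermitian, Matrix.conjTranspose_eq_transpose_of_trivial]
      exact hsymm
    have hp := hA.gammaHatS_posDef hx
    have e : star v ⬝ᵥ (coeffRho (surfaceData g G Ω x)).mulVec v
        = (lapseHat g x ^ 2)⁻¹ * (star (fun A => v (Sum.inl A)) ⬝ᵥ
          (gammaHatS g x).mulVec fun A => v (Sum.inl A)) + 2 * v (Sum.inr ()) ^ 2 := by
      rw [hA.coeffRho_surfaceData hx]
      simp only [Matrix.mulVec, dotProduct, Fintype.sum_sum_type, Matrix.fromBlocks_apply₁₁,
        Matrix.fromBlocks_apply₁₂, Matrix.fromBlocks_apply₂₁, Matrix.fromBlocks_apply₂₂,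
        Matrix.smul_apply, Matrix.of_apply, Matrix.zero_apply, smul_eq_mul, Pi.star_apply,
        star_trivial, Finset.univ_unique, Finset.sum_singleton, PUnit.default_eq_unit,
        Fin.sum_univ_two]
      ring
    rw [e]
    -- If the shift part of v vanishes, its scalar part cannot; otherwise the form of γ̂ is already
    -- strictly positive.
    by_cases hw : (fun A => v (Sum.inl A)) = 0
    · have ht : v (Sum.inr ()) ≠ 0 := fun ht =>
        hv (funext fun c => Sum.casesOn c (fun A => congrFun hw A) fun _ => ht)
      rw [hw]
      simp only [Matrix.mulVec_zero, dotProduct_zero, mul_zero, zero_add]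
      positivity
    · have := hp.dotProduct_mulVec_pos hw
      positivity

end IsAdapted
end FoliatedSpacetime

/-! ### Assembly of the proposition -/

theorem proposition5p1 :
    -- smooth dependence of the principal coefficients on the surface data
    (∀ c d, ContDiffOn ℝ ∞ (fun q => coeffRho q c d) admissible) ∧
    (∀ k c d, ContDiffOn ℝ ∞ (fun q => coeffTan q k c d) admissible) ∧
    -- one source term, smooth in the surface data and in `u`, serves all spacetimes
    ∃ B : SurfaceData × (Comp → ℝ) → Comp → ℝ,
      ContDiffOn ℝ ∞ B (admissible ×ˢ (Set.univ : Set (Comp → ℝ))) ∧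
      ∀ (g G : Pt → Matrix (Fin 4) (Fin 4) ℝ) (Ω : Pt → ℝ) (U : Set Pt),
        IsAdapted g G Ω U → ∀ x ∈ U,
          -- the momentum constraint is equivalent to the two projected equations
          ((∀ j, momentumConstraint g G x j = 0) ↔
            (∀ A, parConst g G Ω x A = 0) ∧ ortConst g G Ω x = 0) ∧
          -- twice the first and `-2 N̂` times the second one form the first order system
          (∀ A, 2 * parConst g G Ω x A =
            system B (surfaceData g G Ω) (unknown g Ω) x (Sum.inl A)) ∧
          (-2 * lapseHat g x * ortConst g G Ω x =
            system B (surfaceData g G Ω) (unknown g Ω) x (Sum.inr ())) ∧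
          -- so that the momentum constraint is equivalent to this system,
          ((∀ j, momentumConstraint g G x j = 0) ↔
            system B (surfaceData g G Ω) (unknown g Ω) x = 0) ∧
          -- which is symmetric hyperbolic with `ρ` as time
          surfaceData g G Ω x ∈ admissible ∧
          IsSymmetricHyperbolic (coeffRho (surfaceData g G Ω x))
            (coeffTan (surfaceData g G Ω x)) := by
  refine ⟨contDiffOn_coeffRho, contDiffOn_coeffTan, SurfaceData.source, contDiffOn_source,
    fun g G Ω U hA x hx => ⟨hA.momentumConstraint_iff hx, hA.two_mul_parConst hx,
      hA.neg_two_mul_ortConst hx, ?_, hA.surfaceData_mem_admissible hx,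
      hA.isSymmetricHyperbolic hx⟩⟩
  have hL := (hA.lapseHat_pos hx).ne'
  rw [hA.momentumConstraint_iff hx, funext_iff, Sum.forall]
  simp only [← hA.two_mul_parConst hx, ← hA.neg_two_mul_ortConst hx, Pi.zero_apply]
  -- The multipliers 2 and -2N̂ are nonzero, so the system vanishes exactly when both projections
  -- do.
  simp [hL]
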